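/- Let $d\ge 2$ be even and let $\mathcal L_0\subset\mathbb R^d$ be a Delone set. Let $\Omega$ be its hull, i.e. the closure of the set of translates $\{\mathcal L_0-a : a\in\mathbb R^d\}$ in the space of closed subsets of $\mathbb R^d$, topologized by the Hausdorff distance between closures in the one-point compactification of $\mathbb R^d$. Let $\Xi=\{\mathcal L\in\Omega : 0\in\mathcal L\}$ be the canonical transversal and $\mathcal G=\{(x,\mathcal L): \mathcal L\in\Xi,\ x\in\mathcal L\}\subset\mathbb R^d\times\Xi$ the canonical groupoid, with composition $(x',\mathcal L-x)(x,\mathcal L)=(x'+x,\mathcal L)$ and inverse $(x,\mathcal L)^{-1}=(-x,\mathcal L-x)$. Let $\mathbb P$ be a $\mathcal G$-invariant Borel probability measure on $\Xi$. On $C_c(\mathcal G)$ put $$(f*g)(x,\mathcal L)=\sum_{y\in\mathcal L}f(x-y,\mathcal L-y)\,g(y,\mathcal L),\quad f^*(\gamma)=\overline{f(\gamma^{-1})},\quad (\partial_jf)(x,\mathcal L)=\imath x_jf(x,\mathcal L),\quad \mathcal T(f)=\int_\Xi f(0,\mathcal L)\,d\mathbb P(\mathcal L),$$ $\|f\|_s=\mathcal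 T(|f|^s)^{1/s}$ (so $\|f\|_d=\mathcal T((f^**f)^{d/2})^{1/d}$), and let $\|f\|_\infty$ be the operator norm of left convolution by $f$ on the Hilbert space $L^2(\mathcal G,\mathcal T)$, the completion of $C_c(\mathcal G)$ under $\|\cdot\|_2$. Then: 1. $\|f\|_W=\|f\|_\infty+\sum_{i=1}^d\|\partial_if\|_d$ is a seminorm on $C_c(\mathcal G)$. Let $W$ be the (Hausdorff) completion of $C_c(\mathcal G)$ under it. The seminorm $\|\cdot\|_\infty$ extends continuously to $W$. 2. $W$ is a locally convex algebra: $C_c(\mathcal G)$ is closed under convolution, and convolution extends to a jointly continuous, bilinear, associative product on $W$ with $\|uv\|_W\le\|u\|_W\|v\|_W$. 3. With $\Lambda_d=\frac{(2\pi\imath)^{d/2}}{(d/2)!}$, the map $$\Sigma_d(f_0,\dots,f_d)=\Lambda_d\sum_{\sigma\in\mathcal S_d}(-1)^\sigma\,\mathcal T\big(f_0\,(\partial_{\sigma_1}f_1)\cdots(\partial_{\sigma_d}f_d)\big)$$ extends from $C_c(\mathcal G)^{d+1}$ to a jointly continuous multilinear map $\Sigma_d:W^{d+1}\to\mathbb C$,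 and the extension is cyclic: $\Sigma_d(f_1,\dots,f_d,f_0)=\Sigma_d(f_0,\dots,f_d)$. 4. For every $M$ there is a constant $C(M)$, depending only on $d$ and $M$, such that for all $f_i,f_i'\in W$ with $\|f_i\|_W\le M$ and $\|f'_i\|_W\le M$ ($0\le i\le d$), $$\big|\Sigma_d(f_0,\dots,f_d)-\Sigma_d(f_0',\dots,f_d')\big|\le C(M)\sum_{i=0}^d\big(\|f_i-f_i'\|_W-\|f_i-f_i'\|_\infty\big).$$ -/

import Mathlib

open scoped CompactlySupported ENNReal

noncomputable section

namespace DelonePattern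

open TopologicalSpace MeasureTheory

/-- The physical space `ℝᵈ` with its Euclidean structure. -/
abbrev Space (d : ℕ) : Type := EuclideanSpace ℝ (Fin d)

/-! ### The space of patterns -/

/-- A pattern: a closed subset of `ℝᵈ`. -/
@[ext]
structure Pattern (d : ℕ) where
  carrier : Set (Space d)
  isClosed : IsClosed carrier

namespace Pattern

variable {d : ℕ}

/-- The closure of a pattern in the one-point compactification of `ℝᵈ`. -/
def bar (L : Pattern d) : Compacts (OnePoint (Space d)) :=
  ⟨closure ((fun x : Space d => (x : OnePoint (Space d))) '' L.carrier),
    isClosed_closure.isCompact⟩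

/-- The pattern topology is the one given by the Hausdorff distance between the closures in the
one-point compactification. On the compact subsets of a compact metrizable space, the topology of
the Hausdorff distance (of any compatible metric) is the Vietoris topology, which is the topology
of `Compacts` in Mathlib. -/
instance : TopologicalSpace (Pattern d) := TopologicalSpace.induced bar inferInstance

/-- The translate `𝔱ₐ(L) = L - a`. -/
def translate (a : Space d) (L : Pattern d) : Pattern d where
  carrier := {y | y + a ∈ L.carrier}
  isClosed := L.isClosed.preimage (continuous_id.add continuous_const)

/-- The pattern underlying a Delone set. -/
def ofDelone (D : Delone.DeloneSet (Space d)) : Pattern d where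
  carrier := D.carrier
  isClosed := by
    obtain ⟨r, hr, h⟩ := D.subset_ball_singleton
    refine isClosed_of_closure_subset fun x hx => ?_
    rw [Metric.mem_closure_iff] at hx
    obtain ⟨y, hy, hxy⟩ := hx r hr
    by_contra hxD
    have hne : 0 < dist x y := dist_pos.2 fun e => hxD (e ▸ hy)
    obtain ⟨z, hz, hxz⟩ := hx (min r (dist x y)) (lt_min hr hne)
    have : y = z := h (z := x) hy hz (by rwa [Metric.mem_ball, dist_comm])
      (by rw [Metric.mem_ball, dist_comm]; exact hxz.trans_le (min_le_left _ _))
    subst this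
    exact absurd (hxz.trans_le (min_le_right _ _)) (lt_irrefl _)

theorem translate_translate (a b : Space d) (L : Pattern d) :
    (L.translate a).translate b = L.translate (b + a) := by
  ext y
  simp [translate, add_assoc]

theorem bar_translate (a : Space d) (L : Pattern d) :
    (L.translate a).bar = L.bar.map (Homeomorph.addRight (-a)).onePointCongr
      (Homeomorph.addRight (-a)).onePointCongr.continuous := by
  apply SetLike.coe_injective
  rw [Compacts.coe_map]
  change closure _ = _ '' closure _
  rw [Homeomorph.image_closure, Set.image_image]
  congr 1
  ext z
  constructor
  · rintro ⟨y, hy, rfl⟩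
    exact ⟨y + a, hy, by simp [Homeomorph.onePointCongr]⟩
  · rintro ⟨y, hy, rfl⟩
    exact ⟨y + -a, by simpa [translate] using hy, by simp [Homeomorph.onePointCongr]⟩

theorem continuous_translate (a : Space d) : Continuous (translate (d := d) a) := by
  rw [continuous_induced_rng]
  have : bar ∘ translate (d := d) a =
      (fun K => K.map _ (Homeomorph.addRight (-a)).onePointCongr.continuous) ∘ bar := by
    ext1 L
    exact bar_translate a L
  rw [this]
  exact (Continuous.compacts_map _).comp continuous_induced_dom

end Pattern

variable {d : ℕ}

/-! ### Hull, transversal and the canonical groupoid of a Delone set -/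

/-- The hull of `L₀`: the closure of its orbit under translations. -/
def hull (L₀ : Delone.DeloneSet (Space d)) : Set (Pattern d) :=
  closure (Set.range fun a : Space d => (Pattern.ofDelone L₀).translate a)

theorem translate_mem_hull {L₀ : Delone.DeloneSet (Space d)} {L : Pattern d} (hL : L ∈ hull L₀)
    (a : Space d) : L.translate a ∈ hull L₀ :=
  map_mem_closure (Pattern.continuous_translate a) hL <| by
    rintro _ ⟨b, rfl⟩
    exact ⟨a + b, (Pattern.translate_translate b a _).symm⟩

/-- The canonical transversal `Ξ` of the hull: the patterns of the hull that contain the origin. -/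
def Transversal (L₀ : Delone.DeloneSet (Space d)) : Type :=
  {L : Pattern d // L ∈ hull L₀ ∧ (0 : Space d) ∈ L.carrier}

variable {L₀ : Delone.DeloneSet (Space d)}

instance : TopologicalSpace (Transversal L₀) :=
  inferInstanceAs (TopologicalSpace {L : Pattern d // L ∈ hull L₀ ∧ (0 : Space d) ∈ L.carrier})

instance : MeasurableSpace (Transversal L₀) := borel _

/-- The points of a pattern of the transversal. -/
def Transversal.points (L : Transversal L₀) : Set (Space d) := L.1.carrier

/-- For a point `x` of `L ∈ Ξ`, the pattern `𝔱ₓ(L) = L - x`, again an element of `Ξ`. -/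
def Transversal.shift (L : Transversal L₀) (x : L.points) : Transversal L₀ :=
  ⟨L.1.translate x, translate_mem_hull L.2.1 x, by
    have h : (x : Space d) ∈ L.1.carrier := x.2
    simpa [Pattern.translate] using h⟩

/-- The canonical groupoid of `L₀`: the pairs `(x, L)` with `L ∈ Ξ` and `x ∈ L`, with the topology
inherited from `ℝᵈ × Ξ`. The source of `(x, L)` is `L`, its range is `𝔱ₓ(L)`. -/
def PatternGroupoid (L₀ : Delone.DeloneSet (Space d)) : Type :=
  {p : Space d × Transversal L₀ // p.1 ∈ p.2.points}

namespace PatternGroupoid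

instance : TopologicalSpace (PatternGroupoid L₀) :=
  inferInstanceAs (TopologicalSpace {p : Space d × Transversal L₀ // p.1 ∈ p.2.points})

instance : MeasurableSpace (PatternGroupoid L₀) := borel _

/-- The element `(x, L)`. -/
def mk (L : Transversal L₀) (x : L.points) : PatternGroupoid L₀ := ⟨(x, L), x.2⟩

/-- The `L` of `(x, L)`. -/
def pattern (γ : PatternGroupoid L₀) : Transversal L₀ := γ.1.2

/-- The `x` of `(x, L)`, as a point of `L`. -/
def point (γ : PatternGroupoid L₀) : γ.pattern.points := ⟨γ.1.1, γ.2⟩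

/-- The unit `(0, L)`. -/
def unit (L : Transversal L₀) : PatternGroupoid L₀ := mk L ⟨0, L.2.2⟩

/-- For `x, y ∈ L`, the element `(x - y, 𝔱_y(L))`, that is `(x, L) · (y, L)⁻¹`. -/
def quot (L : Transversal L₀) (x y : L.points) : PatternGroupoid L₀ :=
  mk (L.shift y) ⟨x - y, by
    have h : (x : Space d) ∈ L.1.carrier := x.2
    simpa [Transversal.points, Transversal.shift, Pattern.translate] using h⟩

/-- The inverse `(x, L)⁻¹ = (-x, 𝔱ₓ(L))`. -/
def inv (γ : PatternGroupoid L₀) : PatternGroupoid L₀ :=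
  mk (γ.pattern.shift γ.point) ⟨-(γ.point : Space d), by
    have h : (0 : Space d) ∈ γ.pattern.1.carrier := γ.pattern.2.2
    simpa [Transversal.points, Transversal.shift, Pattern.translate] using h⟩

end PatternGroupoid

open PatternGroupoid

/-- A Borel measure on the transversal is invariant under the groupoid if the measure it induces on
the groupoid through the counting measures on the source fibres is invariant under inversion. -/
def IsGroupoidInvariant (P : Measure (Transversal L₀)) : Prop :=
  ∀ h : PatternGroupoid L₀ → ℝ≥0∞, Measurable h →
    ∫⁻ L, ∑' x : L.points, h (mk L x) ∂P = ∫⁻ L, ∑' x : L.points, h (inv (mk L x)) ∂P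

/-! ### The convolution algebra, the trace and the derivations -/

/-- The core: continuous compactly supported functions on the groupoid. -/
abbrev Core (L₀ : Delone.DeloneSet (Space d)) : Type := C_c(PatternGroupoid L₀, ℂ)

/-- The convolution `(f ∗ g)(x, L) = ∑_{y ∈ L} f(x - y, L - y) g(y, L)`. -/
def conv (f g : PatternGroupoid L₀ → ℂ) : PatternGroupoid L₀ → ℂ := fun γ =>
  ∑' y : γ.pattern.points, f (quot γ.pattern γ.point y) * g (mk γ.pattern y)

/-- The involution `f*(γ) = conj f(γ⁻¹)`. -/
def invol (f : PatternGroupoid L₀ → ℂ) : PatternGroupoid L₀ → ℂ := fun γ =>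
  starRingEnd ℂ (f (inv γ))

open Classical in
/-- The unit of the convolution: the indicator function of the units `(0, L)`. -/
def convOne : PatternGroupoid L₀ → ℂ := fun γ => if (γ.point : Space d) = 0 then 1 else 0

/-- The convolution product of a list of functions, in the given order. -/
def convProd (l : List (PatternGroupoid L₀ → ℂ)) : PatternGroupoid L₀ → ℂ :=
  l.foldr conv convOne

/-- The trace `𝒯(f) = ∫_Ξ f(0, L) dP(L)`. -/
def trace (P : Measure (Transversal L₀)) (f : PatternGroupoid L₀ → ℂ) : ℂ := ∫ L, f (unit L) ∂P

/-- The derivation `(∂ⱼ f)(x, L) = i xⱼ f(x, L)`. -/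
def deriv (j : Fin d) (f : PatternGroupoid L₀ → ℂ) : PatternGroupoid L₀ → ℂ := fun γ =>
  Complex.I * (((γ.point : Space d) j : ℝ) : ℂ) * f γ

/-! ### Norms -/

/-- The norm `‖f‖ₛ = 𝒯(|f|ˢ)^(1/s)` for an even exponent `s = 2k`, for which
`|f|ˢ = (f* ∗ f)ᵏ`. -/
def evenNorm (P : Measure (Transversal L₀)) (k : ℕ) (f : PatternGroupoid L₀ → ℂ) : ℝ :=
  (trace P (convProd (List.replicate k (conv (invol f) f)))).re ^ (1 / (2 * k : ℝ))

/-- The norm `‖f‖_∞` of the von Neumann algebra `L^∞` of the trace: the operator norm of the left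
convolution by `f` on the Hilbert space `L²` of the trace, in which the core is dense. -/
def inftyNorm (P : Measure (Transversal L₀)) (f : PatternGroupoid L₀ → ℂ) : ℝ :=
  sInf {c : ℝ | 0 ≤ c ∧ ∀ g : Core L₀, evenNorm P 1 (conv f g) ≤ c * evenNorm P 1 g}

/-- The Sobolev norm `‖f‖_W = ‖f‖_∞ + ∑ⱼ ‖∂ⱼ f‖_d`, for even `d`. -/
def sobolevNorm (P : Measure (Transversal L₀)) (f : PatternGroupoid L₀ → ℂ) : ℝ :=
  inftyNorm P f + ∑ j : Fin d, evenNorm P (d / 2) (deriv j f)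

/-! ### The Sobolev space -/

open Classical in
/-- The Sobolev norm as a seminorm on the core, with the value `0` in case the formula does not
define a seminorm (it does when `P` is an invariant probability measure and `d ≥ 2` is even). -/
def sobolevSeminorm (P : Measure (Transversal L₀)) : Seminorm ℂ (Core L₀) :=
  if h : ∃ p : Seminorm ℂ (Core L₀), ∀ f : Core L₀, p f = sobolevNorm P f then h.choose else 0

/-- The core, equipped with the Sobolev norm. -/
def SobolevCore (_P : Measure (Transversal L₀)) : Type := Core L₀

instance (P : Measure (Transversal L₀)) : AddCommGroup (SobolevCore P) :=
  inferInstanceAs (AddCommGroup (Core L₀))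

instance (P : Measure (Transversal L₀)) : Module ℂ (SobolevCore P) :=
  inferInstanceAs (Module ℂ (Core L₀))

instance (P : Measure (Transversal L₀)) : SeminormedAddCommGroup (SobolevCore P) :=
  AddGroupSeminorm.toSeminormedAddCommGroup (E := SobolevCore P)
    (sobolevSeminorm P).toAddGroupSeminorm

instance (P : Measure (Transversal L₀)) : NormedSpace ℂ (SobolevCore P) where
  norm_smul_le c f := ((sobolevSeminorm P).smul' c f).le

/-- The Sobolev space: the (Hausdorff) completion of the core under the Sobolev norm. -/
abbrev SobolevSpace (P : Measure (Transversal L₀)) : Type :=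
  UniformSpace.Completion (SobolevCore P)

/-- The class of an element of the core in the Sobolev space. -/
def toSobolev (P : Measure (Transversal L₀)) (f : Core L₀) : SobolevSpace P :=
  UniformSpace.Completion.coe' (show SobolevCore P from f)

/-- The extension by continuity of `‖·‖_∞` from the core to the Sobolev space. -/
def sobolevInftyNorm (P : Measure (Transversal L₀)) : SobolevSpace P → ℝ :=
  UniformSpace.Completion.extension fun f : SobolevCore P =>
    inftyNorm P (show Core L₀ from f)

/-! ### The cyclic cocycle on the core -/

/-- The constant `Λ_d = (2 π i)^(d/2) / (d/2)!`, for even `d`. -/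
def cocycleConst (d : ℕ) : ℂ :=
  (2 * Complex.I * (Real.pi : ℂ)) ^ (d / 2) / ((d / 2).factorial : ℂ)

/-- `Σ_d(f₀, …, f_d) = Λ_d ∑_σ (-1)^σ 𝒯(f₀ (∂_{σ 1} f₁) ⋯ (∂_{σ d} f_d))`. -/
def cocycle (P : Measure (Transversal L₀)) (f : Fin (d + 1) → PatternGroupoid L₀ → ℂ) : ℂ :=
  cocycleConst d * ∑ σ : Equiv.Perm (Fin d), ((Equiv.Perm.sign σ : ℤ) : ℂ) *
    trace P (convProd (f 0 :: List.ofFn fun j : Fin d => deriv (σ j) (f j.succ)))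

end DelonePattern

end

/-!
The core `C_c(𝒢)` is a `*`-algebra under convolution because the canonical groupoid is étale: by
`packingRadius_le_dist` the patterns of the hull inherit the separation of the Delone set, so that
the source map `(x, L) ↦ L` is a local homeomorphism (`isLocalHomeomorph_pattern`), and sums over
its fibres of compactly supported functions are continuous (`continuous_tsum_fiber`). Invariance of
the measure makes `𝒯` a positive trace on this algebra, and Schur's test bounds the left
convolution operators on `L²` (`ConvAlgebra.positiveTrace`).

The analytic content is the noncommutative Hölder inequality
`|τ(a₁ ⋯ a₂ₖ)| ≤ ‖a₁‖₂ₖ ⋯ ‖a₂ₖ‖₂ₖ` (`PositiveTrace.norm_word_le`). For even exponents it needs no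
spectral theory: it is a chessboard estimate (`chessboard`). A cyclic function of words that
satisfies the Cauchy-Schwarz inequality under reflection attains its maximum, over words in
finitely many normalized letters, at an alternating word `a a* a a* ⋯`, since a reflection of a
maximizing word is again maximizing and can be used to prolong an alternating run. Minkowski's
inequality follows by writing `‖a + b‖₂ₖ²ᵏ` as `τ((a + b) z)` and applying Hölder's inequality to
`τ(a z)` and `τ(b z)`. The inequality `‖a b‖₂ₖ ≤ ‖a‖_∞ ‖b‖₂ₖ` (`PositiveTrace.schatten_mul_le`)
follows by replacing one factor `b* a* a b` of a power by `‖a‖_∞² b* b`. Together they show that the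
Sobolev norm is a submultiplicative seminorm, and that the cocycle is bounded by
`|Λ_d| d! ‖f₀‖_∞ ∏ⱼ N(fⱼ)`, where `N = ‖·‖_W - ‖·‖_∞` measures the derivatives.

Since `τ ∘ ∂ⱼ = 0` and the derivations commute, an integration by parts shows that the cocycle is
cyclic (`altSum_rotate`). Hence any argument, in particular the undifferentiated one, can be moved
to a differentiated place (`norm_sobolev_cocycle_le_at`), and the estimate for the difference of two
values of the cocycle follows by changing the arguments one at a time. Everything extends to the
completion by density; a multilinear map is extended one variable at a time
(`exists_extend_multilinear`).
-/

noncomputable section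

namespace DelonePattern

open TopologicalSpace MeasureTheory PatternGroupoid Topology

/-! ### The chessboard estimate -/

section Chessboard

variable {α : Type*}

/-- The alternating word `a, s a, s (s a), …` of length `n`. -/
def altWord (s : α → α) : α → ℕ → List α
  | _, 0 => []
  | a, n + 1 => a :: altWord s (s a) n

@[simp] theorem length_altWord (s : α → α) (a : α) (n : ℕ) : (altWord s a n).length = n := by
  induction n generalizing a with
  | zero => rfl
  | succ n ih => simp [altWord, ih]

theorem altWord_add (s : α → α) (a : α) (m n : ℕ) :
    altWord s a (m + n) = altWord s a m ++ altWord s (s^[m] a) n := by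
  induction m generalizing a with
  | zero => simp [altWord]
  | succ m ih => simp [altWord, Nat.succ_add, ih]

/-- The reflection of a word: the letters are replaced by their mirror images and the order is
reversed. -/
def mirror (s : α → α) (l : List α) : List α := (l.map s).reverse

@[simp] theorem length_mirror (s : α → α) (l : List α) : (mirror s l).length = l.length := by
  simp [mirror]

theorem mirror_append (s : α → α) (l m : List α) :
    mirror s (l ++ m) = mirror s m ++ mirror s l := by
  simp [mirror]

theorem altWord_append_mirror {s : α → α} (hs : Function.Involutive s) (a : α) (n : ℕ) :
    altWord s a n ++ mirror s (altWord s a n) = altWord s a (2 * n) := by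
  induction n generalizing a with
  | zero => rfl
  | succ n ih =>
    have h : s^[2 * n] (s a) = s a := by rw [hs.iterate_two_mul]; rfl
    have h2 : altWord s (s a) (2 * n + 1) = altWord s (s a) (2 * n) ++ [s a] := by
      rw [altWord_add, h]; rfl
    rw [show altWord s a (2 * (n + 1)) = a :: altWord s (s a) (2 * n + 1) from rfl, h2, ← ih]
    simp [altWord, mirror]

/-- The normalized chessboard estimate. A word that maximizes `G` is still a maximizer after one of
its halves has been replaced by the mirror image of the other half; in this way an alternating run
of letters in a maximizer can be extended until it is the whole word. -/
theorem chessboard_normalized [Finite α] {s : α → α} (hs : Function.Involutive s)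
    {G : List α → ℝ} (hG : ∀ l, 0 ≤ G l) {k : ℕ} (hk : 0 < k)
    (rot : ∀ u v, G (u ++ v) = G (v ++ u))
    (refl : ∀ u v, u.length = k → v.length = k →
      G (u ++ v) ^ 2 ≤ G (u ++ mirror s u) * G (mirror s v ++ v))
    (halt : ∀ a, G (altWord s a (2 * k)) ≤ 1) {w : List α} (hw : w.length = 2 * k) : G w ≤ 1 := by
  obtain ⟨m, hm, hmax⟩ := Set.exists_max_image {l : List α | l.length = 2 * k} G
    (List.finite_length_eq α (2 * k)) ⟨w, hw⟩
  simp only [Set.mem_ofPred_eq] at hm hmax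
  refine (hmax w hw).trans ?_
  by_contra! h1
  have key : ∀ u v : List α, u.length = k → v.length = k → G m ≤ G (u ++ v) →
      G m ≤ G (u ++ mirror s u) := by
    intro u v hu hv huv
    have h2 := refl u v hu hv
    have h3 := hmax (mirror s v ++ v) (by simp [hv]; omega)
    have h4 := hG (u ++ mirror s u)
    by_contra! h5
    nlinarith
  have run : ∀ r : ℕ, r < k → ∃ (b : α) (u v : List α), u.length + (r + 1) = k ∧ v.length = k ∧
      G m ≤ G (u ++ altWord s b (r + 1) ++ v) := by
    intro r
    induction r with
    | zero =>
      intro _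
      have hlen : (m.take k).length = k := by simp [hm]; omega
      have hne : m.take k ≠ [] := by
        intro h
        simp [h] at hlen
        omega
      refine ⟨(m.take k).getLast hne, (m.take k).dropLast, m.drop k, ?_, by simp [hm]; omega, ?_⟩
      · simp [hm]; omega
      · have : altWord s ((m.take k).getLast hne) (0 + 1) = [(m.take k).getLast hne] := rfl
        rw [this, List.dropLast_append_getLast, List.take_append_drop]
    | succ r ih =>
      intro hr
      obtain ⟨b, u, v, hu, hv, h⟩ := ih (by omega)
      have h2 := key _ _ (by simp; omega) hv h
      obtain ⟨x, u, rfl⟩ : ∃ x u', u = x :: u' := by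
        cases u with
        | nil => simp at hu; omega
        | cons x u' => exact ⟨x, u', rfl⟩
      rw [mirror_append, List.append_assoc, ← List.append_assoc (altWord s b (r + 1)),
        altWord_append_mirror hs, show 2 * (r + 1) = (r + 1 + 1) + r by ring, altWord_add] at h2
      refine ⟨b, u, altWord s (s^[r + 1 + 1] b) r ++ mirror s (x :: u) ++ [x], ?_, ?_, ?_⟩
      · simp at hu ⊢; omega
      · simp at hu ⊢; omega
      · refine h2.trans_eq ?_
        have := rot [x] (u ++ (altWord s b (r + 1 + 1) ++ altWord s (s^[r + 1 + 1] b) r ++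
          mirror s (x :: u)))
        simpa using this
  obtain ⟨b, u, v, hu, hv, h⟩ := run (k - 1) (by omega)
  obtain rfl : u = [] := List.length_eq_zero_iff.1 (by omega)
  rw [show k - 1 + 1 = k by omega, List.nil_append] at h
  have h2 := key _ _ (by simp) hv h
  rw [altWord_append_mirror hs] at h2
  linarith [halt b]

theorem prod_map_pos {c : α → ℝ} (hc : ∀ a, 0 < c a) (l : List α) : 0 < (l.map c).prod :=
  List.prod_pos (by simpa using fun a _ => hc a)

theorem prod_map_mirror {s : α → α} {c : α → ℝ} (hcs : ∀ a, c (s a) = c a) (l : List α) :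
    ((mirror s l).map c).prod = (l.map c).prod := by
  rw [mirror, List.map_reverse, List.prod_reverse, List.map_map]
  simp [Function.comp_def, hcs]

theorem prod_map_altWord {s : α → α} {c : α → ℝ} (hcs : ∀ a, c (s a) = c a) (a : α) (n : ℕ) :
    ((altWord s a n).map c).prod = c a ^ n := by
  induction n generalizing a with
  | zero => simp [altWord]
  | succ n ih => simp [altWord, ih, hcs, pow_succ']

/-- The chessboard estimate: a cyclic, reflection positive function of words of even length is
bounded by the product of the values at the alternating words, each to the appropriate power. -/
theorem chessboard [Finite α] {s : α → α} (hs : Function.Involutive s)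
    {G : List α → ℝ} (hG : ∀ l, 0 ≤ G l) {k : ℕ} (hk : 0 < k)
    (rot : ∀ u v, G (u ++ v) = G (v ++ u))
    (refl : ∀ u v, u.length = k → v.length = k →
      G (u ++ v) ^ 2 ≤ G (u ++ mirror s u) * G (mirror s v ++ v))
    {c : α → ℝ} (hc : ∀ a, 0 < c a) (hcs : ∀ a, c (s a) = c a)
    (halt : ∀ a, G (altWord s a (2 * k)) ≤ c a ^ (2 * k)) {w : List α} (hw : w.length = 2 * k) :
    G w ≤ (w.map c).prod := by
  have hp := prod_map_pos hc
  have := chessboard_normalized hs (G := fun l => G l / (l.map c).prod)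
    (fun l => div_nonneg (hG l) (hp l).le) hk
    (fun u v => by simp only [List.map_append, List.prod_append, rot u v, mul_comm])
    (fun u v hu hv => by
      simp only [List.map_append, List.prod_append, prod_map_mirror hcs]
      rw [div_pow, div_mul_div_comm,
        show ∀ x y : ℝ, x * x * (y * y) = (x * y) ^ 2 from fun x y => by ring]
      exact div_le_div_of_nonneg_right (refl u v hu hv) (sq_nonneg _))
    (fun a => by
      rw [prod_map_altWord hcs, div_le_one (pow_pos (hc a) _)]
      exact halt a) hw
  rwa [div_le_one (hp w)] at this

end Chessboard

set_option linter.unusedSectionVars false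

/-! ### Positive traces and noncommutative Hölder inequalities -/

/-- A positive trace `τ` on a (not necessarily unital) complex `*`-algebra, with respect to which
all left multiplications are bounded in the seminorm `τ(b* b)^(1/2)`. -/
structure PositiveTrace (A : Type*) [NonUnitalRing A] [StarRing A] [Module ℂ A] where
  toLinearMap : A →ₗ[ℂ] ℂ
  trace_mul_comm : ∀ a b, toLinearMap (a * b) = toLinearMap (b * a)
  trace_star : ∀ a, toLinearMap (star a) = star (toLinearMap a)
  trace_nonneg : ∀ a, 0 ≤ (toLinearMap (star a * a)).re
  bounded : ∀ a, ∃ C : ℝ, 0 ≤ C ∧ ∀ b, (toLinearMap (star (a * b) * (a * b))).re ≤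
    C ^ 2 * (toLinearMap (star b * b)).re

theorem star_list_prod {R : Type*} [Semiring R] [StarRing R] (l : List R) :
    star l.prod = (l.map star).reverse.prod := by
  induction l with
  | nil => simp
  | cons a l ih => simp [ih]

namespace PositiveTrace

variable {A : Type*} [NonUnitalRing A] [StarRing A] [Module ℂ A] [IsScalarTower ℂ A A]
  [SMulCommClass ℂ A A] [StarModule ℂ A] (τ : PositiveTrace A)

/-- The extension of a trace by `0` to the unitization. It is tracial, but in general not positive;
it serves to write words as products of lists. -/
def ext : Unitization ℂ A →ₗ[ℂ] ℂ := τ.toLinearMap ∘ₗ Unitization.sndHom ℂ ℂ A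

@[simp] theorem ext_inr (a : A) : τ.ext (a : Unitization ℂ A) = τ.toLinearMap a := rfl

theorem ext_mul_comm (x y : Unitization ℂ A) : τ.ext (x * y) = τ.ext (y * x) := by
  simp only [ext, LinearMap.comp_apply, Unitization.sndHom_apply, Unitization.snd_mul, map_add,
    τ.trace_mul_comm x.snd y.snd]
  ring

/-- A word of positive length is an element of the algebra. -/
theorem exists_inr_eq_prod {l : List A} (hl : l ≠ []) :
    ∃ a : A, (l.map (Unitization.inr : A → Unitization ℂ A)).prod = a := by
  induction l with
  | nil => exact absurd rfl hl
  | cons a l ih =>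
    by_cases h : l = []
    · exact ⟨a, by simp [h]⟩
    · obtain ⟨b, hb⟩ := ih h
      exact ⟨a * b, by simp [hb]⟩

/-- The trace of a word. -/
def word (l : List A) : ℂ := τ.ext (l.map (Unitization.inr : A → Unitization ℂ A)).prod

theorem word_append_comm (u v : List A) : τ.word (u ++ v) = τ.word (v ++ u) := by
  simp only [word, List.map_append, List.prod_append]
  exact τ.ext_mul_comm _ _

/-- The Cauchy-Schwarz inequality for the semi-inner product `τ(a* b)`. -/
theorem norm_trace_mul_sq_le (a b : A) : ‖τ.toLinearMap (star a * b)‖ ^ 2 ≤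
    (τ.toLinearMap (star a * a)).re * (τ.toLinearMap (star b * b)).re := by
  let c : PreInnerProductSpace.Core ℂ A :=
    { inner := fun a b => τ.toLinearMap (star a * b)
      conj_inner_symm := fun x y => by
        rw [starRingEnd_apply, ← τ.trace_star]
        simp
      re_inner_nonneg := fun x => τ.trace_nonneg x
      add_left := fun x y z => by simp [add_mul]
      smul_left := fun x y r => by
        rw [star_smul, smul_mul_assoc, map_smul]
        rfl }
  have h := InnerProductSpace.Core.inner_mul_inner_self_le (c := c) a b
  have h2 : ‖τ.toLinearMap (star b * a)‖ = ‖τ.toLinearMap (star a * b)‖ := by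
    rw [← norm_star, ← τ.trace_star]
    simp
  have h3 : ‖τ.toLinearMap (star a * b)‖ * ‖τ.toLinearMap (star b * a)‖ ≤
    (τ.toLinearMap (star a * a)).re * (τ.toLinearMap (star b * b)).re := h
  rw [h2] at h3
  rwa [sq]

theorem norm_word_append_sq_le {u v : List A} (hu : u ≠ []) (hv : v ≠ []) :
    ‖τ.word (u ++ v)‖ ^ 2 ≤ ‖τ.word (u ++ mirror star u)‖ * ‖τ.word (mirror star v ++ v)‖ := by
  obtain ⟨a, ha⟩ := exists_inr_eq_prod hu
  obtain ⟨b, hb⟩ := exists_inr_eq_prod hv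
  have hm : ∀ l : List A, ((mirror star l).map (Unitization.inr : A → Unitization ℂ A)).prod =
      star (l.map (Unitization.inr : A → Unitization ℂ A)).prod := by
    intro l
    rw [star_list_prod]
    simp [mirror, Function.comp_def]
  have h := τ.norm_trace_mul_sq_le (star a) b
  rw [star_star] at h
  simp only [word, List.map_append, List.prod_append, hm, ha, hb, ← Unitization.inr_mul,
    ← Unitization.inr_star, ext_inr]
  exact h.trans (mul_le_mul (Complex.re_le_norm _) (Complex.re_le_norm _) (τ.trace_nonneg b)
    (norm_nonneg _))

/-- `τ((a* a)ᵏ)`, the `2k`-th power of the `2k`-norm. -/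
def moment (k : ℕ) (a : A) : ℂ :=
  τ.ext (((star a * a : A) : Unitization ℂ A) ^ k)

theorem prod_altWord (k : ℕ) (a : A) :
    ((altWord star a (2 * k)).map (Unitization.inr : A → Unitization ℂ A)).prod =
      ((a * star a : A) : Unitization ℂ A) ^ k := by
  induction k with
  | zero => simp [altWord]
  | succ k ih =>
    rw [show 2 * (k + 1) = 2 * k + 1 + 1 by ring, pow_succ', ← ih]
    simp [altWord, mul_assoc]

theorem word_altWord (k : ℕ) (a : A) : τ.word (altWord star a (2 * k)) = τ.moment k (star a) := by
  rw [word, prod_altWord, moment, star_star]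

theorem moment_star {k : ℕ} (hk : 0 < k) (a : A) : τ.moment k (star a) = τ.moment k a := by
  obtain ⟨k, rfl⟩ : ∃ m, k = m + 1 := ⟨k - 1, by omega⟩
  have h : ∀ m, (((a * star a : A) : Unitization ℂ A)) ^ m * a =
      a * (((star a * a : A) : Unitization ℂ A)) ^ m := by
    intro m
    induction m with
    | zero => simp
    | succ m ih =>
      rw [pow_succ', mul_assoc, ih, pow_succ']
      simp only [Unitization.inr_mul, mul_assoc]
  have e : ((a * star a : A) : Unitization ℂ A) ^ (k + 1) =
      a * ((star a * a : A) : Unitization ℂ A) ^ k * (star a : A) := by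
    rw [← h, mul_assoc, ← Unitization.inr_mul, pow_succ]
  rw [moment, moment, star_star, e, ext_mul_comm, ← mul_assoc, ← Unitization.inr_mul, ← pow_succ']

theorem exists_moment_eq {k : ℕ} (hk : 0 < k) (a : A) :
    ∃ b : A, τ.moment k a = τ.toLinearMap (star b * b) := by
  have hself : star ((star a * a : A) : Unitization ℂ A) =
      ((star a * a : A) : Unitization ℂ A) := by
    rw [← Unitization.inr_star]
    simp
  have hpow : ∀ m, 0 < m → ∃ c : A, ((star a * a : A) : Unitization ℂ A) ^ m = c := by
    intro m hm
    obtain ⟨c, hc⟩ := exists_inr_eq_prod (l := List.replicate m (star a * a))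
      (by simpa using hm.ne')
    exact ⟨c, by rwa [List.map_replicate, List.prod_replicate] at hc⟩
  rcases Nat.even_or_odd' k with ⟨m, rfl | rfl⟩
  · obtain ⟨c, hc⟩ := hpow m (by omega)
    refine ⟨c, ?_⟩
    rw [moment, two_mul, pow_add, ← ext_inr, Unitization.inr_mul ℂ (star c), Unitization.inr_star,
      ← hc, star_pow, hself]
  · have : ∃ c : A, (a : Unitization ℂ A) * ((star a * a : A) : Unitization ℂ A) ^ m = c := by
      rcases Nat.eq_zero_or_pos m with rfl | hm
      · exact ⟨a, by simp⟩
      · obtain ⟨c, hc⟩ := hpow m hm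
        exact ⟨a * c, by rw [hc, Unitization.inr_mul]⟩
    obtain ⟨c, hc⟩ := this
    refine ⟨c, ?_⟩
    rw [moment, ← ext_inr, Unitization.inr_mul ℂ (star c), Unitization.inr_star, ← hc, star_mul,
      star_pow, hself, two_mul, pow_succ, pow_add, mul_assoc, mul_assoc, ← mul_assoc (star _),
      ← Unitization.inr_star, ← Unitization.inr_mul, ← pow_succ', ← pow_succ]

theorem trace_star_mul_self_im (b : A) : (τ.toLinearMap (star b * b)).im = 0 := by
  have h := τ.trace_star (star b * b)
  rw [star_mul, star_star] at h
  exact Complex.conj_eq_iff_im.1 h.symm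

theorem moment_re_nonneg {k : ℕ} (hk : 0 < k) (a : A) : 0 ≤ (τ.moment k a).re := by
  obtain ⟨b, hb⟩ := τ.exists_moment_eq hk a
  exact hb ▸ τ.trace_nonneg b

theorem norm_moment {k : ℕ} (hk : 0 < k) (a : A) : ‖τ.moment k a‖ = (τ.moment k a).re := by
  obtain ⟨b, hb⟩ := τ.exists_moment_eq hk a
  have h1 := τ.trace_star_mul_self_im b
  rw [← hb] at h1
  rw [← Complex.abs_re_eq_norm.2 h1, abs_of_nonneg (τ.moment_re_nonneg hk a)]

/-- The norm `τ(|a|²ᵏ)^(1/2k)`. -/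
def schatten (k : ℕ) (a : A) : ℝ := (τ.moment k a).re ^ (1 / (2 * k : ℝ))

theorem schatten_nonneg {k : ℕ} (hk : 0 < k) (a : A) : 0 ≤ τ.schatten k a :=
  Real.rpow_nonneg (τ.moment_re_nonneg hk a) _

theorem schatten_pow {k : ℕ} (hk : 0 < k) (a : A) :
    τ.schatten k a ^ (2 * k) = (τ.moment k a).re := by
  rw [schatten, one_div, ← Nat.cast_ofNat, ← Nat.cast_mul]
  exact Real.rpow_inv_natCast_pow (τ.moment_re_nonneg hk a) (by omega)

theorem schatten_star {k : ℕ} (hk : 0 < k) (a : A) : τ.schatten k (star a) = τ.schatten k a := by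
  rw [schatten, moment_star τ hk, schatten]

/-- The noncommutative Hölder inequality for a word of `2k` factors, all with exponent `2k`. It is
the chessboard estimate for the trace, whose reflection positivity is the Cauchy-Schwarz
inequality. -/
theorem norm_word_le {k : ℕ} (hk : 0 < k) {l : List A} (hl : l.length = 2 * k) :
    ‖τ.word l‖ ≤ (l.map (τ.schatten k)).prod := by
  -- a strictly positive weight is needed for the chessboard estimate
  have key : ∀ ε : ℝ, 0 < ε → ‖τ.word l‖ ≤ (l.map fun a => τ.schatten k a + ε).prod := by
    intro ε hε
    let T : Set A := {x | x ∈ l ∨ star x ∈ l}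
    have hT : T.Finite := by
      have h1 : {x | x ∈ l}.Finite := l.finite_toSet
      exact h1.union (h1.preimage star_injective.injOn)
    have : Finite T := hT
    let s : T → T := fun x => ⟨star x.1, by
      rcases x.2 with h | h
      · exact Or.inr (by simpa using h)
      · exact Or.inl h⟩
    have hs : Function.Involutive s := fun x => Subtype.ext (star_star _)
    have hmir : ∀ u : List T, (mirror s u).map Subtype.val = mirror star (u.map Subtype.val) := by
      intro u
      simp [mirror, Function.comp_def, s]
    have halt : ∀ (n : ℕ) (a : T), (altWord s a n).map Subtype.val = altWord star a.1 n := by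
      intro n
      induction n with
      | zero => intro a; rfl
      | succ n ih => intro a; simp [altWord, ih, s]
    have h := chessboard (α := T) hs (G := fun u => ‖τ.word (u.map Subtype.val)‖)
      (fun _ => norm_nonneg _) hk
      (fun u v => by simp only [List.map_append, τ.word_append_comm (u.map _)])
      (fun u v hu hv => by
        simp only [List.map_append, hmir]
        refine τ.norm_word_append_sq_le ?_ ?_ <;>
        · rw [ne_eq, List.map_eq_nil_iff]
          rintro rfl
          simp at hu hv
          omega)
      (c := fun a => τ.schatten k a.1 + ε)
      (fun a => add_pos_of_nonneg_of_pos (τ.schatten_nonneg hk _) hε)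
      (fun a => by simp only [s, schatten_star τ hk])
      (fun a => by
        rw [halt, word_altWord, moment_star τ hk, norm_moment τ hk, ← schatten_pow τ hk]
        have := τ.schatten_nonneg hk a.1
        gcongr
        linarith)
      (w := l.attachWith (· ∈ T) fun x hx => Or.inl hx) (by simpa using hl)
    rwa [List.attachWith_map_subtype_val,
      show (fun a : T => τ.schatten k a.1 + ε) =
        (fun a => τ.schatten k a + ε) ∘ Subtype.val from rfl,
      ← List.map_map, List.attachWith_map_subtype_val] at h
  have hlim : Filter.Tendsto (fun ε : ℝ => (l.map fun a => τ.schatten k a + ε).prod)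
      (nhdsWithin 0 (Set.Ioi 0)) (nhds (l.map fun a => τ.schatten k a + 0).prod) := by
    refine tendsto_nhdsWithin_of_tendsto_nhds (Continuous.tendsto ?_ 0)
    exact continuous_list_prod _ fun a _ => by fun_prop
  simp only [add_zero] at hlim
  exact ge_of_tendsto hlim (Filter.eventually_of_mem self_mem_nhdsWithin fun ε hε => key ε hε)

/-- The Hölder inequality for a letter and an alternating word. -/
theorem norm_word_cons_altWord_le {k : ℕ} (hk : 0 < k) (a z : A) :
    ‖τ.word (a :: altWord star z (2 * k - 1))‖ ≤
      τ.schatten k a * τ.schatten k z ^ (2 * k - 1) := by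
  have := τ.norm_word_le hk (l := a :: altWord star z (2 * k - 1)) (by simp; omega)
  rwa [List.map_cons, List.prod_cons, prod_map_altWord (τ.schatten_star hk)] at this

theorem schatten_add_le {k : ℕ} (hk : 0 < k) (a b : A) :
    τ.schatten k (a + b) ≤ τ.schatten k a + τ.schatten k b := by
  set z := a + b with hz
  have hw : ∀ x : A, τ.word (x :: altWord star (star z) (2 * k - 1)) = τ.ext
      (x * ((altWord star (star z) (2 * k - 1)).map
        (Unitization.inr : A → Unitization ℂ A)).prod) := by
    intro x
    rw [word, List.map_cons, List.prod_cons]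
  have h1 : τ.word (altWord star z (2 * k)) = τ.word (a :: altWord star (star z) (2 * k - 1)) +
      τ.word (b :: altWord star (star z) (2 * k - 1)) := by
    obtain ⟨m, hm⟩ : ∃ m, 2 * k = m + 1 := ⟨2 * k - 1, by omega⟩
    rw [hw, hw, ← map_add, ← add_mul, ← Unitization.inr_add, ← hz, ← hw, hm]
    rfl
  have h2 : τ.schatten k z ^ (2 * k) ≤
      (τ.schatten k a + τ.schatten k b) * τ.schatten k z ^ (2 * k - 1) := by
    rw [schatten_pow τ hk, ← norm_moment τ hk, ← moment_star τ hk, ← word_altWord, h1]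
    refine (norm_add_le _ _).trans ?_
    rw [add_mul, ← schatten_star τ hk z]
    exact add_le_add (τ.norm_word_cons_altWord_le hk _ _) (τ.norm_word_cons_altWord_le hk _ _)
  rcases (τ.schatten_nonneg hk z).eq_or_lt with h | h
  · rw [← h]
    exact add_nonneg (τ.schatten_nonneg hk a) (τ.schatten_nonneg hk b)
  · have : τ.schatten k z ^ (2 * k) = τ.schatten k z * τ.schatten k z ^ (2 * k - 1) := by
      rw [← pow_succ']
      congr 1
      omega
    rw [this] at h2
    exact le_of_mul_le_mul_right h2 (pow_pos h _)

theorem schatten_smul {k : ℕ} (hk : 0 < k) (c : ℂ) (a : A) :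
    τ.schatten k (c • a) = ‖c‖ * τ.schatten k a := by
  have h : τ.schatten k (c • a) ^ (2 * k) = (‖c‖ * τ.schatten k a) ^ (2 * k) := by
    have h1 : star (c • a) * (c • a) = ((‖c‖ ^ 2 : ℝ) : ℂ) • (star a * a) := by
      rw [star_smul, smul_mul_smul_comm]
      congr 1
      simpa using Complex.normSq_eq_conj_mul_self (z := c) |>.symm.trans
        (by rw [Complex.normSq_eq_norm_sq]; simp)
    rw [mul_pow, schatten_pow τ hk, schatten_pow τ hk, moment, h1, Unitization.inr_smul, smul_pow,
      map_smul, ← Complex.ofReal_pow, smul_eq_mul, Complex.re_ofReal_mul, pow_mul]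
    rfl
  exact (pow_left_inj₀ (τ.schatten_nonneg hk _)
    (mul_nonneg (norm_nonneg _) (τ.schatten_nonneg hk _)) (by omega)).1 h

theorem schatten_one_sq (a : A) : τ.schatten 1 a ^ 2 = (τ.toLinearMap (star a * a)).re := by
  have := τ.schatten_pow one_pos a
  simpa [moment, -Unitization.inr_mul] using this

theorem norm_trace_mul_le (a b : A) :
    ‖τ.toLinearMap (star a * b)‖ ≤ τ.schatten 1 a * τ.schatten 1 b := by
  have h := τ.norm_trace_mul_sq_le a b
  rw [← schatten_one_sq, ← schatten_one_sq, ← mul_pow] at h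
  exact le_of_sq_le_sq h
    (mul_nonneg (τ.schatten_nonneg one_pos a) (τ.schatten_nonneg one_pos b))

/-! ### The operator norm of left multiplication -/

/-- The operator norm of the left multiplication by `a` in the seminorm `τ(b* b)^(1/2)`. -/
def opNorm (a : A) : ℝ :=
  sInf {c : ℝ | 0 ≤ c ∧ ∀ b, τ.schatten 1 (a * b) ≤ c * τ.schatten 1 b}

theorem opNorm_bddBelow (a : A) :
    BddBelow {c : ℝ | 0 ≤ c ∧ ∀ b, τ.schatten 1 (a * b) ≤ c * τ.schatten 1 b} :=
  ⟨0, fun _ h => h.1⟩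

theorem opNorm_le {a : A} {c : ℝ} (hc : 0 ≤ c)
    (h : ∀ b, τ.schatten 1 (a * b) ≤ c * τ.schatten 1 b) : τ.opNorm a ≤ c :=
  csInf_le (τ.opNorm_bddBelow a) ⟨hc, h⟩

theorem opNorm_set_nonempty (a : A) :
    {c : ℝ | 0 ≤ c ∧ ∀ b, τ.schatten 1 (a * b) ≤ c * τ.schatten 1 b}.Nonempty := by
  obtain ⟨C, hC, h⟩ := τ.bounded a
  refine ⟨C, hC, fun b => ?_⟩
  have h2 := h b
  rw [← schatten_one_sq, ← schatten_one_sq, ← mul_pow] at h2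
  exact le_of_sq_le_sq h2 (mul_nonneg hC (τ.schatten_nonneg one_pos b))

theorem opNorm_nonneg (a : A) : 0 ≤ τ.opNorm a :=
  le_csInf (τ.opNorm_set_nonempty a) fun _ h => h.1

theorem schatten_one_mul_le (a b : A) :
    τ.schatten 1 (a * b) ≤ τ.opNorm a * τ.schatten 1 b := by
  rcases (τ.schatten_nonneg one_pos b).eq_or_lt with h | h
  · obtain ⟨c, hc⟩ := τ.opNorm_set_nonempty a
    have := hc.2 b
    rwa [← h, mul_zero] at this ⊢
  · rw [← div_le_iff₀ h]
    exact le_csInf (τ.opNorm_set_nonempty a) fun c hc => (div_le_iff₀ h).2 (hc.2 b)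

theorem opNorm_add_le (a b : A) : τ.opNorm (a + b) ≤ τ.opNorm a + τ.opNorm b := by
  refine τ.opNorm_le (add_nonneg (τ.opNorm_nonneg a) (τ.opNorm_nonneg b)) fun x => ?_
  rw [add_mul, add_mul]
  exact (τ.schatten_add_le one_pos _ _).trans
    (add_le_add (τ.schatten_one_mul_le a x) (τ.schatten_one_mul_le b x))

theorem opNorm_mul_le (a b : A) : τ.opNorm (a * b) ≤ τ.opNorm a * τ.opNorm b := by
  refine τ.opNorm_le (mul_nonneg (τ.opNorm_nonneg a) (τ.opNorm_nonneg b)) fun x => ?_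
  rw [mul_assoc, mul_assoc]
  exact (τ.schatten_one_mul_le _ _).trans
    (mul_le_mul_of_nonneg_left (τ.schatten_one_mul_le b x) (τ.opNorm_nonneg a))

theorem opNorm_smul_le (c : ℂ) (a : A) : τ.opNorm (c • a) ≤ ‖c‖ * τ.opNorm a := by
  refine τ.opNorm_le (mul_nonneg (norm_nonneg c) (τ.opNorm_nonneg a)) fun x => ?_
  rw [smul_mul_assoc, schatten_smul τ one_pos, mul_assoc]
  exact mul_le_mul_of_nonneg_left (τ.schatten_one_mul_le a x) (norm_nonneg c)

theorem opNorm_star_le (a : A) : τ.opNorm (star a) ≤ τ.opNorm a := by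
  refine τ.opNorm_le (τ.opNorm_nonneg a) fun x => ?_
  have h1 : τ.schatten 1 (star a * x) ^ 2 ≤
      τ.schatten 1 x * (τ.opNorm a * τ.schatten 1 (star a * x)) := by
    rw [schatten_one_sq, star_mul, star_star, mul_assoc]
    exact (Complex.re_le_norm _).trans ((τ.norm_trace_mul_le _ _).trans
      (mul_le_mul_of_nonneg_left (τ.schatten_one_mul_le _ _) (τ.schatten_nonneg one_pos _)))
  rcases (τ.schatten_nonneg one_pos (star a * x)).eq_or_lt with h | h
  · rw [← h]
    exact mul_nonneg (τ.opNorm_nonneg a) (τ.schatten_nonneg one_pos _)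
  · refine le_of_mul_le_mul_right ?_ h
    nlinarith

theorem opNorm_star (a : A) : τ.opNorm (star a) = τ.opNorm a :=
  le_antisymm (τ.opNorm_star_le a) (by simpa using τ.opNorm_star_le (star a))

/-! ### Mixed Hölder inequalities -/

/-- The operator inequality `b* a* a b ≤ ‖a‖_∞² b* b`, tested under the trace. -/
theorem re_ext_conj_le (a b : A) (z : Unitization ℂ A) :
    (τ.ext (star z * ((star (a * b) * (a * b) : A) : Unitization ℂ A) * z)).re ≤
      τ.opNorm a ^ 2 * (τ.ext (star z * ((star b * b : A) : Unitization ℂ A) * z)).re := by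
  obtain ⟨y, hy⟩ : ∃ y : A, (b : Unitization ℂ A) * z = y := by
    refine ⟨((b : Unitization ℂ A) * z).snd, ?_⟩
    ext <;> simp
  have h1 : star z * ((star b * b : A) : Unitization ℂ A) * z = (star y * y : A) := by
    rw [Unitization.inr_mul ℂ (star y), Unitization.inr_star, ← hy, star_mul, Unitization.inr_mul,
      Unitization.inr_star]
    simp only [mul_assoc]
  have h2 : star z * ((star (a * b) * (a * b) : A) : Unitization ℂ A) * z =
      (star (a * y) * (a * y) : A) := by
    rw [Unitization.inr_mul ℂ (star (a * y)), Unitization.inr_star, Unitization.inr_mul ℂ a y, ← hy,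
      Unitization.inr_mul ℂ (star (a * b)), Unitization.inr_star, Unitization.inr_mul ℂ a b]
    simp only [star_mul, mul_assoc]
  rw [h1, h2, ext_inr, ext_inr, ← schatten_one_sq, ← schatten_one_sq, ← mul_pow]
  exact pow_le_pow_left₀ (τ.schatten_nonneg one_pos _) (τ.schatten_one_mul_le a y) 2

/-- Hölder's inequality `‖a b‖₂ₖ ≤ ‖a‖_∞ ‖b‖₂ₖ`: with `x = b* a* a b`, one replaces one factor `x`
of `xᵏ` by the larger `‖a‖_∞² b* b`, and estimates the trace of the resulting word. -/
theorem schatten_mul_le {k : ℕ} (hk : 0 < k) (a b : A) :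
    τ.schatten k (a * b) ≤ τ.opNorm a * τ.schatten k b := by
  set c := a * b with hc
  obtain ⟨n, rfl⟩ : ∃ n, k = n + 1 := ⟨k - 1, by omega⟩
  set x : Unitization ℂ A := ((star c * c : A) : Unitization ℂ A) with hx
  have hself : star x = x := by
    rw [hx, ← Unitization.inr_star]
    simp
  have h1 : (τ.ext (x ^ n * x)).re ≤
      τ.opNorm a ^ 2 * (τ.ext (x ^ n * ((star b * b : A) : Unitization ℂ A))).re := by
    -- `x ^ n` has the form `z * star z`
    obtain ⟨z, hz⟩ : ∃ z, x ^ n = z * star z := by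
      rcases Nat.even_or_odd' n with ⟨m, rfl | rfl⟩
      · exact ⟨x ^ m, by rw [star_pow, hself, ← pow_add, two_mul]⟩
      · refine ⟨x ^ m * star (c : Unitization ℂ A), ?_⟩
        rw [star_mul, star_star, star_pow, hself, mul_assoc, ← mul_assoc (star _),
          ← Unitization.inr_star, ← Unitization.inr_mul, ← hx, ← pow_succ', ← pow_add]
        congr 1
        ring
    have h := τ.re_ext_conj_le a b z
    have hcyc : ∀ w, τ.ext (x ^ n * w) = τ.ext (star z * w * z) := fun w => by
      rw [hz, ext_mul_comm, ← mul_assoc, ext_mul_comm, mul_assoc]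
    rw [hcyc, hcyc]
    exact h
  have h2 : (τ.ext (x ^ n * ((star b * b : A) : Unitization ℂ A))).re ≤
      τ.schatten (n + 1) c ^ (2 * n) * τ.schatten (n + 1) b ^ 2 := by
    have h3 := τ.norm_word_le hk (l := altWord star (star c) (2 * n) ++ [star b, b])
      (by simp; ring)
    rw [word, List.map_append, List.prod_append, prod_altWord, star_star, List.map_append,
      List.prod_append, prod_map_altWord (τ.schatten_star hk)] at h3
    simp only [List.map_cons, List.map_nil, List.prod_cons, List.prod_nil, mul_one,
      schatten_star τ hk] at h3
    rw [← Unitization.inr_mul, ← sq] at h3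
    exact (Complex.re_le_norm _).trans h3
  rw [← pow_succ] at h1
  have h4 : τ.schatten (n + 1) c ^ (2 * (n + 1)) = (τ.ext (x ^ (n + 1))).re := schatten_pow τ hk c
  rw [← h4] at h1
  rcases (τ.schatten_nonneg hk c).eq_or_lt with h | h
  · rw [← h]
    exact mul_nonneg (τ.opNorm_nonneg a) (τ.schatten_nonneg hk b)
  · have h5 : τ.schatten (n + 1) c ^ 2 ≤ (τ.opNorm a * τ.schatten (n + 1) b) ^ 2 := by
      refine le_of_mul_le_mul_left ?_ (pow_pos h (2 * n))
      calc τ.schatten (n + 1) c ^ (2 * n) * τ.schatten (n + 1) c ^ 2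
          = τ.schatten (n + 1) c ^ (2 * (n + 1)) := by ring
        _ ≤ _ := h1.trans (mul_le_mul_of_nonneg_left h2 (sq_nonneg _))
        _ = _ := by ring
    exact le_of_sq_le_sq h5 (mul_nonneg (τ.opNorm_nonneg a) (τ.schatten_nonneg hk b))

theorem schatten_mul_le' {k : ℕ} (hk : 0 < k) (a b : A) :
    τ.schatten k (a * b) ≤ τ.schatten k a * τ.opNorm b := by
  rw [← schatten_star τ hk, star_mul, mul_comm, ← schatten_star τ hk a, ← opNorm_star]
  exact τ.schatten_mul_le hk _ _

/-- Hölder's inequality for one factor in `L^∞` and `2k` factors with exponent `2k`. -/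
theorem norm_word_cons_le {k : ℕ} (hk : 0 < k) (a : A) {l : List A} (hl : l.length = 2 * k) :
    ‖τ.word (a :: l)‖ ≤ τ.opNorm a * (l.map (τ.schatten k)).prod := by
  obtain ⟨b, l, rfl⟩ : ∃ b l', l = b :: l' := by
    cases l with
    | nil => simp at hl; omega
    | cons b l => exact ⟨b, l, rfl⟩
  have h1 : τ.word (a :: b :: l) = τ.word ((a * b) :: l) := by
    simp [word, mul_assoc]
  rw [h1]
  refine (τ.norm_word_le hk (by simpa using hl)).trans ?_
  rw [List.map_cons, List.prod_cons, List.map_cons, List.prod_cons, ← mul_assoc]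
  refine mul_le_mul_of_nonneg_right (τ.schatten_mul_le hk a b) (List.prod_nonneg ?_)
  simpa using fun a _ => τ.schatten_nonneg hk a

end PositiveTrace

/-! ### Cyclic cocycles from commuting derivations -/

section Cyclic

variable {B : Type*} [Ring B] [Algebra ℂ B]

theorem map_prod_ofFn_of_leibniz {δ : B →ₗ[ℂ] B} (hδ : ∀ x y, δ (x * y) = δ x * y + x * δ y)
    {n : ℕ} (h : Fin n → B) :
    δ (List.ofFn h).prod = ∑ i, (List.ofFn (Function.update h i (δ (h i)))).prod := by
  induction n with
  | zero =>
    have := hδ 1 1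
    simp only [mul_one, one_mul, left_eq_add] at this
    simpa using this
  | succ n ih =>
    rw [List.ofFn_succ, List.prod_cons, hδ, ih, Fin.sum_univ_succ, Finset.mul_sum]
    congr 1
    · simp [List.ofFn_succ]
    · refine Finset.sum_congr rfl fun i _ => ?_
      rw [List.ofFn_succ, List.prod_cons, Function.update_of_ne (Fin.succ_ne_zero i).symm]
      congr 3
      ext j
      by_cases hj : j = i
      · subst hj; simp
      · rw [Function.update_of_ne hj, Function.update_of_ne (by simpa using hj)]

/-- The antisymmetrized sum `∑_σ (-1)^σ τ(b₀ δ_{σ 1} b₁ ⋯ δ_{σ d} b_d)`. -/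
def altSum (τ : B →ₗ[ℂ] ℂ) {d : ℕ} (δ : Fin d → B →ₗ[ℂ] B) (b : Fin (d + 1) → B) : ℂ :=
  ∑ σ : Equiv.Perm (Fin d), ((Equiv.Perm.sign σ : ℤ) : ℂ) *
    τ (b 0 * (List.ofFn fun j : Fin d => δ (σ j) (b j.succ)).prod)

/-- In the antisymmetrized sum, the terms with a second derivative cancel. -/
theorem sum_sign_second_derivative_eq_zero {n : ℕ} {τ : B →ₗ[ℂ] ℂ} {δ : Fin (n + 1) → B →ₗ[ℂ] B}
    (hδ : ∀ j x y, δ j (x * y) = δ j x * y + x * δ j y)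
    (hcomm : ∀ i j x, δ i (δ j x) = δ j (δ i x)) (c : B) (g : Fin n → B) :
    ∑ σ : Equiv.Perm (Fin (n + 1)), ((Equiv.Perm.sign σ : ℤ) : ℂ) *
      τ (c * δ (σ (Fin.last n)) (List.ofFn fun j : Fin n => δ (σ j.castSucc) (g j)).prod) = 0 := by
  simp only [map_prod_ofFn_of_leibniz (hδ _), Finset.mul_sum, map_sum]
  rw [Finset.sum_comm]
  refine Finset.sum_eq_zero fun i _ => ?_
  -- the exchange of the two indices at the place of the second derivative reverses the sign
  let w : Equiv.Perm (Fin (n + 1)) := Equiv.swap i.castSucc (Fin.last n)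
  have hw : Equiv.Perm.sign w = -1 := Equiv.Perm.sign_swap (Fin.castSucc_lt_last i).ne
  set F : Equiv.Perm (Fin (n + 1)) → ℂ := fun σ => ((Equiv.Perm.sign σ : ℤ) : ℂ) *
    τ (c * (List.ofFn (Function.update (fun j : Fin n => δ (σ j.castSucc) (g j)) i
      (δ (σ (Fin.last n)) (δ (σ i.castSucc) (g i))))).prod) with hF
  have h : ∀ σ, F (σ * w) = -F σ := by
    intro σ
    have h1 : Function.update (fun j : Fin n => δ ((σ * w) j.castSucc) (g j)) i
        (δ ((σ * w) (Fin.last n)) (δ ((σ * w) i.castSucc) (g i))) =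
        Function.update (fun j : Fin n => δ (σ j.castSucc) (g j)) i
        (δ (σ (Fin.last n)) (δ (σ i.castSucc) (g i))) := by
      ext j
      by_cases hj : j = i
      · subst hj
        simp [w, hcomm (σ j.castSucc)]
      · rw [Function.update_of_ne hj, Function.update_of_ne hj, Equiv.Perm.mul_apply,
          Equiv.swap_apply_of_ne_of_ne (by simpa using hj) (Fin.castSucc_lt_last j).ne]
    simp only [hF, h1, map_mul, hw]
    simp
  have h2 : ∑ σ, F σ = -∑ σ, F σ := by
    rw [← Finset.sum_neg_distrib, ← Equiv.sum_comp (Equiv.mulRight w)]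
    exact Finset.sum_congr rfl fun σ _ => h σ
  exact self_eq_neg.1 h2

/-- The antisymmetrized sum is cyclic in even degree: after an integration by parts of the
derivative that falls on the last argument, the terms with a second derivative cancel and the
remaining one is a cyclic permutation, of sign `-1`, of the original sum. -/
theorem altSum_rotate {d : ℕ} (hd : Even d) (hd0 : 0 < d) {τ : B →ₗ[ℂ] ℂ} {δ : Fin d → B →ₗ[ℂ] B}
    (hτ : ∀ x y, τ (x * y) = τ (y * x)) (hδ : ∀ j x y, δ j (x * y) = δ j x * y + x * δ j y)
    (hcomm : ∀ i j x, δ i (δ j x) = δ j (δ i x)) (hτδ : ∀ j x, τ (δ j x) = 0)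
    (b : Fin (d + 1) → B) : altSum τ δ (fun i => b (i + 1)) = altSum τ δ b := by
  obtain ⟨n, rfl⟩ : ∃ n, d = n + 1 := ⟨d - 1, by omega⟩
  have hn : Odd n := by
    by_contra h
    rw [Nat.not_odd_iff_even] at h
    exact (Nat.not_even_iff_odd.2 h.add_one) hd
  let g : Fin n → B := fun j => b j.succ.succ
  have h1 : ∀ j : Fin n, b (j.castSucc.succ + 1) = g j := by
    intro j
    simp only [g]
    congr 1
    rw [Fin.succ_castSucc, Fin.coeSucc_eq_succ]
  have h2 : b ((Fin.last n).succ + 1) = b 0 := by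
    congr 1
    rw [Fin.succ_last, Fin.last_add_one]
  have key : ∀ σ : Equiv.Perm (Fin (n + 1)),
      τ (b (0 + 1) * (List.ofFn fun j : Fin (n + 1) => δ (σ j) (b (j.succ + 1))).prod) =
      - τ (b 0 * (δ (σ (Fin.last n)) (b 1) *
        (List.ofFn fun j : Fin n => δ (σ j.castSucc) (g j)).prod))
      - τ (b 0 * b 1 * δ (σ (Fin.last n))
        (List.ofFn fun j : Fin n => δ (σ j.castSucc) (g j)).prod) := by
    intro σ
    rw [List.ofFn_succ_last, List.prod_append, List.prod_singleton, h2, zero_add]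
    simp only [h1]
    set Q := (List.ofFn fun j : Fin n => δ (σ j.castSucc) (g j)).prod
    have h3 := hτδ (σ (Fin.last n)) (b 1 * Q * b 0)
    rw [hδ, hδ, map_add, add_mul, map_add, hτ _ (b 0), hτ _ (b 0)] at h3
    rw [← mul_assoc (b 1), mul_assoc (b 0) (b 1)]
    linear_combination h3
  have h4 : ∀ σ : Equiv.Perm (Fin (n + 1)),
      ((Equiv.Perm.sign (σ * (finRotate (n + 1))⁻¹) : ℤ) : ℂ) =
        - ((Equiv.Perm.sign σ : ℤ) : ℂ) := by
    intro σ
    rw [map_mul, Equiv.Perm.sign_inv, sign_finRotate, add_tsub_cancel_right, hn.neg_one_pow]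
    simp
  have h5 : ∀ j : Fin n, (finRotate (n + 1))⁻¹ j.succ = j.castSucc := by
    intro j
    rw [Equiv.Perm.inv_eq_iff_eq, finRotate_apply, Fin.coeSucc_eq_succ]
  have h6 : (finRotate (n + 1))⁻¹ 0 = Fin.last n := by
    rw [Equiv.Perm.inv_eq_iff_eq, finRotate_last]
  simp only [altSum, key, mul_sub, Finset.sum_sub_distrib,
    sum_sign_second_derivative_eq_zero hδ hcomm, sub_zero]
  rw [← Equiv.sum_comp (Equiv.mulRight (finRotate (n + 1))⁻¹)
    (fun σ : Equiv.Perm (Fin (n + 1)) => ((Equiv.Perm.sign σ : ℤ) : ℂ) *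
      τ (b 0 * (List.ofFn fun j : Fin (n + 1) => δ (σ j) (b j.succ)).prod))]
  refine Finset.sum_congr rfl fun σ _ => ?_
  rw [Equiv.coe_mulRight, h4, List.ofFn_succ, List.prod_cons]
  simp only [Equiv.Perm.mul_apply, h5, h6]
  rw [mul_neg, neg_mul]
  rfl

end Cyclic

/-! ### Extension of multilinear maps to completions -/

section Extension

open UniformSpace

variable {V : Type*} [SeminormedAddCommGroup V] [NormedSpace ℂ V]

theorem extend_toComplL_coe {F : Type*} [NormedAddCommGroup F] [NormedSpace ℂ F] [CompleteSpace F]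
    (f : V →L[ℂ] F) (x : V) :
    f.extend (Completion.toComplL (𝕜 := ℂ)) (x : Completion V) = f x :=
  f.extend_eq (e := Completion.toComplL (𝕜 := ℂ)) Completion.denseRange_coe
    (Completion.isUniformInducing_coe V) x

/-- The extension of a continuous linear map to the completion of its domain. -/
def extendCompletion {F : Type*} [NormedAddCommGroup F] [NormedSpace ℂ F]
    [CompleteSpace F] : (V →L[ℂ] F) →L[ℂ] (Completion V →L[ℂ] F) :=
  LinearMap.mkContinuous
    { toFun := fun f => f.extend Completion.toComplL
      map_add' := fun f g => by
        refine ContinuousLinearMap.extend_unique _ Completion.denseRange_coe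
          (Completion.isUniformInducing_coe V) _ ?_
        ext x
        simp [extend_toComplL_coe]
      map_smul' := fun c f => by
        refine ContinuousLinearMap.extend_unique _ Completion.denseRange_coe
          (Completion.isUniformInducing_coe V) _ ?_
        ext x
        simp [extend_toComplL_coe] } 1 <| fun f => by
    rw [one_mul]
    refine ContinuousLinearMap.opNorm_le_bound _ (norm_nonneg f) fun x => ?_
    induction x using Completion.induction_on with
    | hp => exact isClosed_le (by fun_prop) (by fun_prop)
    | ih x =>
      simp only [LinearMap.coe_mk, AddHom.coe_mk, extend_toComplL_coe, Completion.norm_coe]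
      exact f.le_opNorm x

@[simp] theorem extendCompletion_coe {F : Type*} [NormedAddCommGroup F] [NormedSpace ℂ F]
    [CompleteSpace F] (f : V →L[ℂ] F) (x : V) : extendCompletion f (x : Completion V) = f x :=
  extend_toComplL_coe f x

end Extension

/-- The separation of the last variable of a continuous multilinear map on a seminormed space. -/
def curryLast {V F : Type*} [SeminormedAddCommGroup V] [NormedSpace ℂ V]
    [NormedAddCommGroup F] [NormedSpace ℂ F] {n : ℕ}
    (T : ContinuousMultilinearMap ℂ (fun _ : Fin (n + 1) => V) F) :
    ContinuousMultilinearMap ℂ (fun _ : Fin n => V) (V →L[ℂ] F) :=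
  have h : ∀ (v : Fin n → V) (x : V),
      ‖MultilinearMap.curryRight (M := fun _ => V) T.toMultilinearMap v x‖ ≤
        ‖T‖ * (∏ i, ‖v i‖) * ‖x‖ := fun v x => by
    refine (T.le_opNorm (Fin.snoc v x)).trans_eq ?_
    rw [Fin.prod_univ_castSucc, mul_assoc]
    simp
  MultilinearMap.mkContinuous
    { toFun := fun v =>
        (MultilinearMap.curryRight (M := fun _ => V) T.toMultilinearMap v).mkContinuous
          (‖T‖ * ∏ i, ‖v i‖) (h v)
      map_update_add' := fun m i x y => by
        ext
        simp
      map_update_smul' := fun m i c x => by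
        ext
        simp } ‖T‖ fun v =>
    LinearMap.mkContinuous_norm_le _ (by positivity) (h v)

theorem curryLast_apply {V F : Type*} [SeminormedAddCommGroup V] [NormedSpace ℂ V]
    [NormedAddCommGroup F] [NormedSpace ℂ F] {n : ℕ}
    (T : ContinuousMultilinearMap ℂ (fun _ : Fin (n + 1) => V) F) (v : Fin n → V) (x : V) :
    curryLast T v x = T (Fin.snoc v x) := rfl

/-- A continuous multilinear map into a complete space extends to the completions; one variable is
extended at a time. -/
theorem exists_extend_multilinear {V : Type} [SeminormedAddCommGroup V] [NormedSpace ℂ V] {n : ℕ}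
    {F : Type} [NormedAddCommGroup F] [NormedSpace ℂ F] [CompleteSpace F]
    (T : ContinuousMultilinearMap ℂ (fun _ : Fin n => V) F) :
    ∃ S : ContinuousMultilinearMap ℂ (fun _ : Fin n => UniformSpace.Completion V) F,
      ∀ v : Fin n → V, S (fun i => (v i : UniformSpace.Completion V)) = T v := by
  induction n generalizing F with
  | zero =>
    refine ⟨ContinuousMultilinearMap.constOfIsEmpty ℂ _ (T 0), fun v => ?_⟩
    rw [Subsingleton.elim v 0]
    rfl
  | succ n ih =>
    obtain ⟨S, hS⟩ := ih (F := UniformSpace.Completion V →L[ℂ] F)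
      (extendCompletion.compContinuousMultilinearMap (curryLast T))
    refine ⟨ContinuousMultilinearMap.uncurryRight S, fun v => ?_⟩
    rw [ContinuousMultilinearMap.uncurryRight_apply]
    have : (Fin.init fun i => (v i : UniformSpace.Completion V)) =
        fun i => ((Fin.init v i : V) : UniformSpace.Completion V) := rfl
    rw [this, hS]
    change extendCompletion (curryLast T (Fin.init v))
      (v (Fin.last n) : UniformSpace.Completion V) = T v
    rw [extendCompletion_coe, curryLast_apply, Fin.snoc_init_self]

variable {d : ℕ}

/-! ### The topology of the groupoid -/

namespace Pattern

theorem coe_mem_bar {L : Pattern d} {x : Space d} :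
    (x : OnePoint (Space d)) ∈ L.bar ↔ x ∈ L.carrier := by
  change (x : OnePoint (Space d)) ∈ closure _ ↔ _
  have h := (OnePoint.isOpenEmbedding_coe
    (X := Space d)).isInducing.closure_eq_preimage_closure_image L.carrier
  rw [L.isClosed.closure_eq] at h
  conv_rhs => rw [h]
  rfl

theorem bar_injective : Function.Injective (bar (d := d)) := by
  intro L L' h
  ext x
  rw [← coe_mem_bar, h, coe_mem_bar]

theorem continuous_bar : Continuous (bar (d := d)) := continuous_induced_dom

instance : T2Space (Pattern d) := T2Space.of_injective_continuous bar_injective continuous_bar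

/-- The patterns that meet a given open set form an open set. -/
theorem isOpen_hits {U : Set (Space d)} (hU : IsOpen U) :
    IsOpen {L : Pattern d | (L.carrier ∩ U).Nonempty} := by
  have h := (Compacts.isOpen_inter_nonempty_of_isOpen
    (OnePoint.isOpen_image_coe.2 hU)).preimage (continuous_bar (d := d))
  convert h using 1
  ext L
  constructor
  · rintro ⟨x, hx, hxU⟩
    exact ⟨x, coe_mem_bar.2 hx, x, hxU, rfl⟩
  · rintro ⟨_, hx, x, hxU, rfl⟩
    exact ⟨x, coe_mem_bar.1 hx, hxU⟩

open scoped Pointwise in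
/-- The translations act jointly continuously on the one-point compactification. -/
theorem continuous_onePoint_translate : Continuous
    (Function.uncurry fun (a : Space d) (z : OnePoint (Space d)) =>
      (Homeomorph.addRight (-a)).onePointCongr z) := by
  rw [continuous_iff_continuousAt]
  rintro ⟨a, z⟩
  induction z using OnePoint.rec with
  | coe x =>
    have h : IsOpenEmbedding (Prod.map id ((↑) : Space d → OnePoint (Space d)) :
        Space d × Space d → Space d × OnePoint (Space d)) :=
      IsOpenEmbedding.id.prodMap OnePoint.isOpenEmbedding_coe
    have h2 : (a, (x : OnePoint (Space d))) = Prod.map id (↑) (a, x) := rfl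
    rw [h2, ← h.continuousAt_iff]
    have h3 : ((Function.uncurry fun (a : Space d) (z : OnePoint (Space d)) =>
      (Homeomorph.addRight (-a)).onePointCongr z) ∘
        Prod.map id ((↑) : Space d → OnePoint (Space d))) =
        fun p : Space d × Space d => ((p.2 + -p.1 : Space d) : OnePoint (Space d)) := rfl
    rw [h3]
    exact (OnePoint.continuous_coe.comp (by fun_prop)).continuousAt
  | infty =>
    change Filter.Tendsto _ _ (𝓝 OnePoint.infty)
    rw [(OnePoint.hasBasis_nhds_infty (X := Space d)).tendsto_right_iff]
    rintro K ⟨-, hK⟩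
    -- the translates of `K` by vectors close to `a` stay in a compact set
    have hK' : IsCompact (Metric.closedBall a 1 + K) := (isCompact_closedBall a 1).add hK
    have h1 : Metric.closedBall a 1 ∈ 𝓝 a := Metric.closedBall_mem_nhds a one_pos
    have h2 : ((↑) '' (Metric.closedBall a 1 + K)ᶜ ∪ {OnePoint.infty} : Set (OnePoint (Space d))) ∈
        𝓝 OnePoint.infty :=
      (OnePoint.hasBasis_nhds_infty (X := Space d)).mem_of_mem ⟨hK'.isClosed, hK'⟩
    filter_upwards [prod_mem_nhds h1 h2]
    rintro ⟨b, z⟩ ⟨hb, hz⟩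
    rcases hz with ⟨y, hy, rfl⟩ | rfl
    · refine Or.inl ⟨y + -b, fun hyb => hy ?_, rfl⟩
      exact ⟨b, hb, y + -b, hyb, by simp⟩
    · exact Or.inr rfl

/-- The translation `(a, L) ↦ L - a` is jointly continuous. -/
theorem continuous_translate_uncurry :
    Continuous fun p : Space d × Pattern d => p.2.translate p.1 := by
  rw [continuous_induced_rng]
  have h : (bar ∘ fun p : Space d × Pattern d => p.2.translate p.1) = fun p : Space d × Pattern d =>
      p.2.bar.map (Homeomorph.addRight (-p.1)).onePointCongr
        (Homeomorph.addRight (-p.1)).onePointCongr.continuous := by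
    ext1 p
    exact bar_translate p.1 p.2
  rw [h]
  refine Continuous.compacts_map' (f := fun p : Space d × Pattern d => p.2.bar)
    (g := fun p z => (Homeomorph.addRight (-p.1)).onePointCongr z)
    (continuous_bar.comp continuous_snd) ?_
  exact continuous_onePoint_translate.comp
    (f := fun q : (Space d × Pattern d) × OnePoint (Space d) => (q.1.1, q.2)) (by fun_prop)

end Pattern

variable {L₀ : Delone.DeloneSet (Space d)}

/-- The patterns of the hull inherit the separation of the Delone set. -/
theorem packingRadius_le_dist {L : Pattern d} (hL : L ∈ hull L₀) {x y : Space d}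
    (hx : x ∈ L.carrier) (hy : y ∈ L.carrier) (hxy : x ≠ y) :
    (L₀.packingRadius : ℝ) ≤ dist x y := by
  by_contra! hlt
  set ε := min (dist x y / 2) ((L₀.packingRadius - dist x y) / 2) with hε
  have hd : 0 < dist x y := dist_pos.2 hxy
  have hε0 : 0 < ε := lt_min (by linarith) (by linarith)
  have hε1 : ε ≤ dist x y / 2 := min_le_left _ _
  have hε2 : ε ≤ (L₀.packingRadius - dist x y) / 2 := min_le_right _ _
  have hU := (Pattern.isOpen_hits (Metric.isOpen_ball (x := x) (ε := ε))).inter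
    (Pattern.isOpen_hits (Metric.isOpen_ball (x := y) (ε := ε)))
  obtain ⟨_, ⟨⟨u, hu, hux⟩, v, hv, hvy⟩, a, rfl⟩ := mem_closure_iff.1 hL _ hU
    ⟨⟨x, hx, Metric.mem_ball_self hε0⟩, y, hy, Metric.mem_ball_self hε0⟩
  rw [Metric.mem_ball] at hux hvy
  have hne : u + a ≠ v + a := by
    intro h
    rw [add_right_cancel h] at hux
    have := dist_triangle_right x y v
    rw [dist_comm v x] at hux
    rw [dist_comm v y] at hvy
    linarith
  have h1 := L₀.packingRadius_lt_dist_of_mem_ne (x := u + a) (y := v + a) hu hv hne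
  rw [dist_add_right] at h1
  have h2 := dist_triangle4 u x y v
  rw [dist_comm y v] at h2
  linarith

instance : T2Space (Transversal L₀) :=
  inferInstanceAs (T2Space {L : Pattern d // L ∈ hull L₀ ∧ (0 : Space d) ∈ L.carrier})

instance : T2Space (PatternGroupoid L₀) :=
  inferInstanceAs (T2Space {p : Space d × Transversal L₀ // p.1 ∈ p.2.points})

instance : BorelSpace (Transversal L₀) := ⟨rfl⟩

instance : BorelSpace (PatternGroupoid L₀) := ⟨rfl⟩

namespace PatternGroupoid

theorem continuous_pattern : Continuous (pattern (L₀ := L₀)) :=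
  continuous_snd.comp continuous_subtype_val

theorem continuous_point : Continuous fun γ : PatternGroupoid L₀ => (γ.point : Space d) :=
  continuous_fst.comp continuous_subtype_val

theorem ext {γ η : PatternGroupoid L₀} (h1 : (γ.point : Space d) = η.point)
    (h2 : γ.pattern = η.pattern) : γ = η :=
  Subtype.ext (Prod.ext h1 h2)

theorem continuous_iff {T : Type*} [TopologicalSpace T] {f : T → PatternGroupoid L₀} :
    Continuous f ↔ Continuous (fun t => ((f t).point : Space d)) ∧
      Continuous fun t => (f t).pattern := by
  constructor
  · exact fun h => ⟨continuous_point.comp h, continuous_pattern.comp h⟩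
  · exact fun h => Continuous.subtype_mk (h.1.prodMk h.2) _

theorem continuous_transversal_iff {T : Type*} [TopologicalSpace T] {f : T → Transversal L₀} :
    Continuous f ↔ Continuous (fun t => (f t).1) := continuous_induced_rng

theorem continuous_shift : Continuous fun γ : PatternGroupoid L₀ => γ.pattern.shift γ.point := by
  rw [continuous_transversal_iff]
  exact Pattern.continuous_translate_uncurry.comp
    (continuous_point.prodMk (continuous_subtype_val.comp continuous_pattern))

theorem continuous_unit : Continuous (unit (L₀ := L₀)) :=
  continuous_iff.2 ⟨continuous_const, continuous_id⟩

theorem continuous_inv : Continuous (inv (L₀ := L₀)) :=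
  continuous_iff.2 ⟨continuous_point.neg, continuous_shift⟩

/-- The source map of the groupoid is a local homeomorphism: the groupoid is étale. -/
theorem isLocalHomeomorph_pattern : IsLocalHomeomorph (pattern (L₀ := L₀)) := by
  rw [isLocalHomeomorph_iff_isOpenEmbedding_restrict]
  intro γ
  have hr : (0 : ℝ) < L₀.packingRadius / 2 := by
    have : (0 : ℝ) < L₀.packingRadius := L₀.packingRadius_pos
    positivity
  let U : Set (PatternGroupoid L₀) :=
    {η | (η.point : Space d) ∈ Metric.ball (γ.point : Space d) (L₀.packingRadius / 2)}
  have hU : IsOpen U := Metric.isOpen_ball.preimage continuous_point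
  have hopen : IsOpenMap (pattern (L₀ := L₀)) := by
    intro W hW
    obtain ⟨W', hW', rfl⟩ := isOpen_induced_iff.1 hW
    rw [isOpen_iff_forall_mem_open]
    rintro _ ⟨η, hη, rfl⟩
    obtain ⟨A, B, hA, hB, hηA, hηB, hAB⟩ := isOpen_prod_iff.1 hW' _ _ hη
    refine ⟨B ∩ {L | (L.1.carrier ∩ A).Nonempty}, ?_, hB.inter
      ((Pattern.isOpen_hits hA).preimage continuous_subtype_val), hηB, ⟨_, η.2, hηA⟩⟩
    rintro L ⟨hLB, x, hx, hxA⟩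
    exact ⟨mk L ⟨x, hx⟩, hAB ⟨hxA, hLB⟩, rfl⟩
  refine ⟨U, hU.mem_nhds (Metric.mem_ball_self hr), ?_⟩
  refine IsOpenEmbedding.of_continuous_injective_isOpenMap
    (continuous_pattern.comp continuous_subtype_val) ?_ (hopen.domRestrict hU)
  rintro ⟨η, hη⟩ ⟨θ, hθ⟩ h
  change η.pattern = θ.pattern at h
  refine Subtype.ext (ext ?_ h)
  by_contra hne
  have h1 : (η.point : Space d) ∈ η.pattern.1.carrier := η.2
  have h2 : (θ.point : Space d) ∈ η.pattern.1.carrier := by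
    rw [h]
    exact θ.2
  have h3 := packingRadius_le_dist η.pattern.2.1 h1 h2 hne
  have h4 := dist_triangle_right (η.point : Space d) (θ.point : Space d) (γ.point : Space d)
  have h5 : dist (η.point : Space d) γ.point < L₀.packingRadius / 2 := hη
  have h6 : dist (θ.point : Space d) γ.point < L₀.packingRadius / 2 := hθ
  linarith

end PatternGroupoid

/-! ### Sums over the fibres of a local homeomorphism -/

section FiberSum

variable {X B : Type*} [TopologicalSpace X] [TopologicalSpace B] [T2Space B] {s : X → B}

theorem finite_fiber_inter_of_isCompact (hs : IsLocalHomeomorph s) {K : Set X} (hK : IsCompact K)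
    (b : B) : {x | s x = b ∧ x ∈ K}.Finite := by
  have hc : IsCompact {x | s x = b ∧ x ∈ K} :=
    hK.inter_left (isClosed_singleton.preimage hs.continuous)
  refine hc.finite ?_
  rw [isDiscrete_iff_forall_mem_exists_isOpen]
  rintro x ⟨hx, hxK⟩
  obtain ⟨e, hxe, rfl⟩ := hs x
  refine ⟨e.source, e.open_source, ?_⟩
  ext y
  constructor
  · rintro ⟨hye, hy, -⟩
    exact e.injOn hye hxe (hy.trans hx.symm)
  · rintro rfl
    exact ⟨hxe, hx, hxK⟩

/-- Let `s` be a local homeomorphism of Hausdorff spaces. The sums over the fibres of `s` of a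
continuous function that depends on a parameter and vanishes off a compact set depend continuously
on the parameter: near a given parameter, the compact set meets the fibre only in finitely many
disjoint sheets, on each of which `s` has a continuous section. -/
theorem continuous_tsum_fiber [T2Space X] (hs : IsLocalHomeomorph s) {T : Type*}
    [TopologicalSpace T] {p : T → B} (hp : Continuous p) {K : Set X} (hK : IsCompact K)
    {E : Type*} [AddCommGroup E]
    [TopologicalSpace E] [ContinuousAdd E] {F : T × X → E}
    (hF : ContinuousOn F {q | p q.1 = s q.2}) (hFK : ∀ t x, x ∉ K → F (t, x) = 0) :
    Continuous fun t => ∑' x : {x // s x = p t}, F (t, x) := by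
  rw [continuous_iff_continuousAt]
  intro t₀
  have hS := finite_fiber_inter_of_isCompact hs hK (p t₀)
  set S := {x | s x = p t₀ ∧ x ∈ K} with hSdef
  choose e he hes using hs
  obtain ⟨U, hU, hdisj⟩ := hS.t2_separation
  let W : X → Set X := fun x => U x ∩ (e x).source
  have hW : ∀ x, IsOpen (W x) := fun x => (hU x).2.inter (e x).open_source
  have hxW : ∀ x, x ∈ W x := fun x => ⟨(hU x).1, he x⟩
  have hsc : Continuous s := IsLocalHomeomorph.continuous fun x => ⟨e x, he x, hes x⟩
  have hso : IsOpenMap s := IsLocalHomeomorph.isOpenMap fun x => ⟨e x, he x, hes x⟩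
  let V : Set B := (⋂ x ∈ S, s '' W x) ∩ (s '' (K \ ⋃ x ∈ S, W x))ᶜ
  have hV : IsOpen V := by
    refine (hS.isOpen_biInter fun x _ => hso _ (hW x)).inter ?_
    refine IsClosed.isOpen_compl (self := ?_)
    exact ((hK.diff (isOpen_biUnion fun x _ => hW x)).image hsc).isClosed
  have htV : p t₀ ∈ V := by
    refine ⟨Set.mem_iInter₂.2 fun x hx => ⟨x, hxW x, hx.1⟩, ?_⟩
    rintro ⟨x, ⟨hxK, hx⟩, hxt⟩
    exact hx (Set.mem_biUnion (show x ∈ S from ⟨hxt, hxK⟩) (hxW x))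
  have hsymm : ∀ x ∈ S, ∀ b ∈ V, (e x).symm b ∈ W x ∧ s ((e x).symm b) = b := by
    intro x hx b hb
    obtain ⟨w, hw, rfl⟩ := Set.mem_iInter₂.1 hb.1 x hx
    have h1 : (e x).symm (s w) = w := by
      conv_lhs => rw [hes x]
      exact (e x).left_inv hw.2
    rw [h1]
    exact ⟨hw, rfl⟩
  have : Fintype S := hS.fintype
  have hsum : ∀ t, p t ∈ V →
      ∑' x : {x // s x = p t}, F (t, x) = ∑ x : S, F (t, (e x).symm (p t)) := by
    intro t ht
    let φ : S → {x // s x = p t} := fun x => ⟨(e x).symm (p t), (hsymm x x.2 _ ht).2⟩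
    have hφ : Function.Injective φ := by
      intro x y hxy
      by_contra hne
      have h1 : (e x).symm (p t) = (e y).symm (p t) := congrArg Subtype.val hxy
      have h2 := (hsymm x x.2 _ ht).1.1
      have h3 := (hsymm y y.2 _ ht).1.1
      rw [← h1] at h3
      exact Set.disjoint_left.1 (hdisj x.2 y.2 fun h => hne (Subtype.ext h)) h2 h3
    rw [← hφ.tsum_eq (f := fun x : {x // s x = p t} => F (t, x)), tsum_fintype]
    rintro ⟨x, hx⟩ hxF
    have hxK : x ∈ K := by
      by_contra h
      exact hxF (hFK t x h)
    have h4 : x ∈ ⋃ y ∈ S, W y := by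
      by_contra h
      exact ht.2 ⟨x, ⟨hxK, h⟩, hx⟩
    obtain ⟨y, hy, hxy⟩ := Set.mem_iUnion₂.1 h4
    refine ⟨⟨y, hy⟩, Subtype.ext ?_⟩
    change (e y).symm (p t) = x
    rw [← hx]
    conv_lhs => rw [hes y]
    exact (e y).left_inv hxy.2
  have hev : ∀ᶠ t in 𝓝 t₀, p t ∈ V := hp.continuousAt.eventually (hV.mem_nhds htV)
  have hcont : ContinuousAt (fun t => ∑ x : S, F (t, (e x).symm (p t))) t₀ := by
    refine tendsto_finsetSum _ fun x _ => ?_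
    have h1 : s ((e x).symm (p t₀)) = p t₀ := (hsymm x x.2 _ htV).2
    have h2 : ContinuousAt (fun t => (t, (e x).symm (p t))) t₀ := by
      refine continuousAt_id.prodMk (ContinuousAt.comp (f := p) ?_ hp.continuousAt)
      refine (e x).continuousAt_symm ?_
      have : p t₀ = e x x := by rw [← hes x]; exact x.2.1.symm
      rw [this]
      exact (e x).map_source (he x)
    refine (hF (t₀, (e x).symm (p t₀)) h1.symm).tendsto.comp (tendsto_nhdsWithin_iff.2 ⟨h2, ?_⟩)
    filter_upwards [hev] with t ht
    exact (hsymm x x.2 _ ht).2.symm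
  exact hcont.congr (hev.mono fun t ht => (hsum t ht).symm)

end FiberSum


/-! ### The groupoid as a family of equivalence relations -/

namespace PatternGroupoid

theorem mk_pattern_point (γ : PatternGroupoid L₀) : mk γ.pattern γ.point = γ := rfl

theorem mem_points_of_eq {L L' : Transversal L₀} (h : L = L') {x : Space d} (hx : x ∈ L.points) :
    x ∈ L'.points := h ▸ hx

/-- The points of `L` are the elements of the groupoid with source `L`. -/
def pointsEquiv (L : Transversal L₀) : L.points ≃ {γ : PatternGroupoid L₀ // pattern γ = L} where
  toFun y := ⟨mk L y, rfl⟩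
  invFun γ := ⟨γ.1.point, mem_points_of_eq γ.2 γ.1.point.2⟩
  left_inv _ := rfl
  right_inv γ := Subtype.ext (ext rfl γ.2.symm)

/-- The origin as a point of `L`. -/
def origin (L : Transversal L₀) : L.points := ⟨0, L.2.2⟩

theorem shift_val_eq {L : Transversal L₀} {y : L.points} {a : Space d} (z : (L.shift y).points)
    (hz : (z : Space d) + y = a) (ha : a ∈ L.points) : (L.shift y).shift z = L.shift ⟨a, ha⟩ := by
  apply Subtype.ext
  change (L.1.translate y).translate z = L.1.translate a
  rw [Pattern.translate_translate, hz]

theorem shift_origin (L : Transversal L₀) : L.shift (origin L) = L := by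
  apply Subtype.ext
  apply Pattern.ext
  ext y
  simp [Transversal.shift, Pattern.translate, origin]

theorem quot_origin (L : Transversal L₀) (x : L.points) : quot L x (origin L) = mk L x :=
  ext (sub_zero _) (shift_origin L)

theorem quot_origin_left (L : Transversal L₀) (x : L.points) :
    quot L (origin L) x = inv (mk L x) :=
  ext (zero_sub _) rfl

theorem inv_quot (L : Transversal L₀) (x y : L.points) : inv (quot L x y) = quot L y x := by
  refine ext (neg_sub _ _) ?_
  exact shift_val_eq _ (sub_add_cancel _ _) x.2

theorem inv_inv (γ : PatternGroupoid L₀) : inv (inv γ) = γ := by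
  conv_lhs => rw [← mk_pattern_point γ]
  rw [← quot_origin_left, inv_quot, quot_origin, mk_pattern_point]

/-- The translation by `-y`, as a bijection between the points of `L` and those of `L - y`. -/
def shiftEquiv (L : Transversal L₀) (y : L.points) : L.points ≃ (L.shift y).points where
  toFun x := (quot L x y).point
  invFun z := ⟨z + y, z.2⟩
  left_inv _ := Subtype.ext (sub_add_cancel _ _)
  right_inv _ := Subtype.ext (add_sub_cancel_right _ _)

theorem mk_shiftEquiv (L : Transversal L₀) (x y : L.points) :
    mk (L.shift y) (shiftEquiv L y x) = quot L x y := rfl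

theorem quot_shiftEquiv (L : Transversal L₀) (x y w : L.points) :
    quot (L.shift y) (shiftEquiv L y x) (shiftEquiv L y w) = quot L x w :=
  ext (sub_sub_sub_cancel_right _ _ _) (shift_val_eq _ (sub_add_cancel _ _) w.2)

theorem finite_mk_mem {K : Set (PatternGroupoid L₀)} (hK : IsCompact K) (L : Transversal L₀) :
    {x : L.points | mk L x ∈ K}.Finite := by
  have h := finite_fiber_inter_of_isCompact isLocalHomeomorph_pattern hK L
  exact (h.preimage (f := fun x => mk L x) (fun _ _ _ _ hxy =>
     Subtype.ext (congrArg (fun γ : PatternGroupoid L₀ => (γ.point : Space d)) hxy))).subset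
      fun _ hx => ⟨rfl, hx⟩

theorem finite_quot_mem {K : Set (PatternGroupoid L₀)} (hK : IsCompact K) (L : Transversal L₀)
    (y : L.points) : {x : L.points | quot L x y ∈ K}.Finite :=
  (finite_mk_mem hK (L.shift y)).preimage (f := shiftEquiv L y) (shiftEquiv L y).injective.injOn

theorem finite_quot_mem' {K : Set (PatternGroupoid L₀)} (hK : IsCompact K) (L : Transversal L₀)
    (x : L.points) : {y : L.points | quot L x y ∈ K}.Finite := by
  refine (finite_quot_mem (hK.image continuous_inv) L x).subset fun y hy => ⟨_, hy, ?_⟩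
  exact inv_quot L x y

end PatternGroupoid

/-! ### The convolution of compactly supported functions -/

theorem tsum_points_eq {E : Type*} [AddCommMonoid E] [TopologicalSpace E] (L : Transversal L₀)
    (h : PatternGroupoid L₀ → E) :
    ∑' y : L.points, h (mk L y) = ∑' γ : {γ : PatternGroupoid L₀ // pattern γ = L}, h γ :=
  (pointsEquiv L).tsum_eq fun γ : {γ : PatternGroupoid L₀ // pattern γ = L} => h γ

theorem apply_eq_zero_of_notMem_tsupport {f : PatternGroupoid L₀ → ℂ} {γ : PatternGroupoid L₀}
    (h : γ ∉ tsupport f) : f γ = 0 := image_eq_zero_of_notMem_tsupport h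

theorem finite_support_mk {f : PatternGroupoid L₀ → ℂ} (hf : HasCompactSupport f)
    (L : Transversal L₀) : (Function.support fun x : L.points => f (mk L x)).Finite :=
  (finite_mk_mem hf L).subset fun _ hx => subset_tsupport f hx

theorem finite_support_quot {f : PatternGroupoid L₀ → ℂ} (hf : HasCompactSupport f)
    (L : Transversal L₀) (y : L.points) :
    (Function.support fun x : L.points => f (quot L x y)).Finite :=
  (finite_quot_mem hf L y).subset fun _ hx => subset_tsupport f hx

theorem finite_support_quot' {f : PatternGroupoid L₀ → ℂ} (hf : HasCompactSupport f)
    (L : Transversal L₀) (x : L.points) :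
    (Function.support fun y : L.points => f (quot L x y)).Finite :=
  (finite_quot_mem' hf L x).subset fun _ hx => subset_tsupport f hx

open Classical in
theorem continuous_conv {f g : PatternGroupoid L₀ → ℂ} (hf : Continuous f) (hg : Continuous g)
    (hgc : HasCompactSupport g) : Continuous (conv f g) := by
  let F : PatternGroupoid L₀ × PatternGroupoid L₀ → ℂ := fun q =>
    if h : q.1.pattern = q.2.pattern then
      f (quot q.2.pattern ⟨q.1.point, mem_points_of_eq h q.1.point.2⟩ q.2.point) * g q.2 else 0
  have hF : ContinuousOn F {q | q.1.pattern = q.2.pattern} := by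
    rw [continuousOn_iff_continuous_domRestrict]
    have h : Set.domRestrict
        {q : PatternGroupoid L₀ × PatternGroupoid L₀ | q.1.pattern = q.2.pattern} F =
        fun q => f (quot q.1.2.pattern ⟨q.1.1.point, mem_points_of_eq q.2 q.1.1.point.2⟩
          q.1.2.point) * g q.1.2 := by
      ext q
      exact dif_pos q.2
    rw [h]
    refine (hf.comp (continuous_iff.2 ⟨?_, ?_⟩)).mul
      (hg.comp (continuous_snd.comp continuous_subtype_val))
    · exact (continuous_point.comp (continuous_fst.comp continuous_subtype_val)).sub
        (continuous_point.comp (continuous_snd.comp continuous_subtype_val))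
    · exact continuous_shift.comp (continuous_snd.comp continuous_subtype_val)
  have h := continuous_tsum_fiber isLocalHomeomorph_pattern continuous_pattern hgc.isCompact hF
    (fun γ η hη => by
      simp only [F]
      split_ifs
      · rw [apply_eq_zero_of_notMem_tsupport hη, mul_zero]
      · rfl)
  refine h.congr fun γ => ?_
  rw [← tsum_points_eq γ.pattern fun η => F (γ, η)]
  refine tsum_congr fun y => ?_
  exact dif_pos rfl

theorem hasCompactSupport_conv {f g : PatternGroupoid L₀ → ℂ} (hf : HasCompactSupport f)
    (hg : HasCompactSupport g) : HasCompactSupport (conv f g) := by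
  let D : Set (PatternGroupoid L₀ × PatternGroupoid L₀) :=
    {q | q.1.pattern = q.2.pattern.shift q.2.point}
  have hD : IsClosed D := isClosed_eq (continuous_pattern.comp continuous_fst)
    (continuous_shift.comp continuous_snd)
  let m : D → PatternGroupoid L₀ := fun q => mk q.1.2.pattern ⟨q.1.1.point + q.1.2.point,
    mem_points_of_eq (show q.1.1.pattern = q.1.2.pattern.shift q.1.2.point from q.2)
      q.1.1.point.2⟩
  have hm : Continuous m := by
    refine continuous_iff.2 ⟨?_, ?_⟩
    · exact (continuous_point.comp (continuous_fst.comp continuous_subtype_val)).add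
        (continuous_point.comp (continuous_snd.comp continuous_subtype_val))
    · change Continuous fun q : D => q.1.2.pattern
      exact continuous_pattern.comp (continuous_snd.comp continuous_subtype_val)
  refine HasCompactSupport.intro
    ((hD.isClosedEmbedding_subtypeVal.isCompact_preimage (hf.isCompact.prod hg.isCompact)).image hm)
    fun γ hγ => ?_
  have h0 : ∀ y : γ.pattern.points, f (quot γ.pattern γ.point y) * g (mk γ.pattern y) = 0 := by
    intro y
    by_contra hne
    refine hγ ⟨⟨(quot γ.pattern γ.point y, mk γ.pattern y), rfl⟩, ⟨?_, ?_⟩,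
      ext (sub_add_cancel _ _) rfl⟩
    · exact subset_tsupport f (left_ne_zero_of_mul hne)
    · exact subset_tsupport g (right_ne_zero_of_mul hne)
  change ∑' y : γ.pattern.points, _ = _
  simp only [h0, tsum_zero]

theorem invol_apply (f : PatternGroupoid L₀ → ℂ) (γ : PatternGroupoid L₀) :
    invol f γ = star (f (inv γ)) := rfl

theorem continuous_invol {f : PatternGroupoid L₀ → ℂ} (hf : Continuous f) : Continuous (invol f) :=
  continuous_star.comp (hf.comp continuous_inv)

theorem hasCompactSupport_invol {f : PatternGroupoid L₀ → ℂ} (hf : HasCompactSupport f) :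
    HasCompactSupport (invol f) := by
  refine HasCompactSupport.intro (hf.isCompact.image continuous_inv) fun γ hγ => ?_
  rw [invol_apply, apply_eq_zero_of_notMem_tsupport fun h => hγ ⟨_, h, inv_inv γ⟩, star_zero]

theorem continuous_deriv (j : Fin d) {f : PatternGroupoid L₀ → ℂ} (hf : Continuous f) :
    Continuous (deriv j f) := by
  refine (continuous_const.mul (Complex.continuous_ofReal.comp ?_)).mul hf
  exact (EuclideanSpace.proj (𝕜 := ℝ) j).continuous.comp continuous_point

theorem hasCompactSupport_deriv (j : Fin d) {f : PatternGroupoid L₀ → ℂ}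
    (hf : HasCompactSupport f) : HasCompactSupport (deriv j f) := hf.mul_left

/-- In terms of the matrices `(x, y) ↦ f(x - y, L - y)`, the convolution is the product. -/
theorem conv_quot (f g : PatternGroupoid L₀ → ℂ) (L : Transversal L₀) (x y : L.points) :
    conv f g (quot L x y) = ∑' w : L.points, f (quot L x w) * g (quot L w y) := by
  have h := (shiftEquiv L y).tsum_eq fun w =>
    f (quot (L.shift y) (shiftEquiv L y x) w) * g (mk (L.shift y) w)
  refine Eq.trans ?_ (h.symm.trans ?_)
  · rfl
  · simp only [quot_shiftEquiv, mk_shiftEquiv]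

theorem invol_quot (f : PatternGroupoid L₀ → ℂ) (L : Transversal L₀) (x y : L.points) :
    invol f (quot L x y) = star (f (quot L y x)) := by
  rw [invol_apply, inv_quot]

theorem funext_quot {f g : PatternGroupoid L₀ → ℂ}
    (h : ∀ (L : Transversal L₀) (x y : L.points), f (quot L x y) = g (quot L x y)) : f = g := by
  ext γ
  have := h γ.pattern γ.point (origin γ.pattern)
  rwa [quot_origin, mk_pattern_point] at this

theorem conv_assoc {f g h : PatternGroupoid L₀ → ℂ} (hf : HasCompactSupport f)
    (hh : HasCompactSupport h) : conv (conv f g) h = conv f (conv g h) := by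
  refine funext_quot fun L x y => ?_
  have hR := finite_support_quot' hf L x
  have hS := finite_support_quot hh L y
  have hR0 : ∀ v ∉ hR.toFinset, f (quot L x v) = 0 := fun v hv => by simpa using hv
  have hS0 : ∀ w ∉ hS.toFinset, h (quot L w y) = 0 := fun w hw => by simpa using hw
  rw [conv_quot, conv_quot, tsum_eq_sum (s := hS.toFinset) fun w hw => by rw [hS0 w hw, mul_zero],
    tsum_eq_sum (s := hR.toFinset) fun w hw => by rw [hR0 w hw, zero_mul]]
  have h1 : ∀ w, conv f g (quot L x w) = ∑ v ∈ hR.toFinset, f (quot L x v) * g (quot L v w) :=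
    fun w => by
      rw [conv_quot, tsum_eq_sum (s := hR.toFinset) fun v hv => by rw [hR0 v hv, zero_mul]]
  have h2 : ∀ v, conv g h (quot L v y) = ∑ w ∈ hS.toFinset, g (quot L v w) * h (quot L w y) :=
    fun v => by
      rw [conv_quot, tsum_eq_sum (s := hS.toFinset) fun w hw => by rw [hS0 w hw, mul_zero]]
  simp only [h1, h2, Finset.sum_mul, Finset.mul_sum]
  rw [Finset.sum_comm]
  simp only [mul_assoc]

theorem conv_add {f g h : PatternGroupoid L₀ → ℂ} (hg : HasCompactSupport g)
    (hh : HasCompactSupport h) : conv f (g + h) = conv f g + conv f h := by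
  ext γ
  simp only [conv, Pi.add_apply, mul_add]
  refine Summable.tsum_add ?_ ?_
  · exact summable_of_hasFiniteSupport ((finite_support_mk hg γ.pattern).subset fun y hy =>
      right_ne_zero_of_mul hy)
  · exact summable_of_hasFiniteSupport ((finite_support_mk hh γ.pattern).subset fun y hy =>
      right_ne_zero_of_mul hy)

theorem add_conv {f g h : PatternGroupoid L₀ → ℂ} (hh : HasCompactSupport h) :
    conv (f + g) h = conv f h + conv g h := by
  ext γ
  simp only [conv, Pi.add_apply, add_mul]
  refine Summable.tsum_add ?_ ?_ <;>
  exact summable_of_hasFiniteSupport ((finite_support_mk hh γ.pattern).subset fun y hy =>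
      right_ne_zero_of_mul hy)

theorem smul_conv (c : ℂ) (f g : PatternGroupoid L₀ → ℂ) : conv (c • f) g = c • conv f g := by
  ext γ
  simp only [conv, Pi.smul_apply, smul_eq_mul, mul_assoc, tsum_mul_left]

theorem conv_smul (c : ℂ) (f g : PatternGroupoid L₀ → ℂ) : conv f (c • g) = c • conv f g := by
  ext γ
  simp only [conv, Pi.smul_apply, smul_eq_mul, mul_left_comm _ c, tsum_mul_left]

theorem zero_conv (f : PatternGroupoid L₀ → ℂ) : conv 0 f = 0 := by
  simpa using smul_conv 0 0 f

theorem conv_zero (f : PatternGroupoid L₀ → ℂ) : conv f 0 = 0 := by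
  simpa using conv_smul 0 f 0

theorem invol_conv (f g : PatternGroupoid L₀ → ℂ) :
    invol (conv f g) = conv (invol g) (invol f) := by
  refine funext_quot fun L x y => ?_
  rw [invol_quot, conv_quot, conv_quot, tsum_star]
  simp only [invol_quot, star_mul]

theorem invol_invol (f : PatternGroupoid L₀ → ℂ) : invol (invol f) = f := by
  ext γ
  rw [invol_apply, invol_apply, star_star, inv_inv]

theorem conv_convOne (f : PatternGroupoid L₀ → ℂ) : conv f convOne = f := by
  ext γ
  change ∑' y : γ.pattern.points, _ = _
  rw [tsum_eq_single (origin γ.pattern)]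
  · rw [quot_origin, mk_pattern_point]
    have : convOne (mk γ.pattern (origin γ.pattern)) = 1 := if_pos rfl
    rw [this, mul_one]
  · intro y hy
    have : convOne (mk γ.pattern y) = 0 := if_neg fun h => hy (Subtype.ext h)
    rw [this, mul_zero]

theorem deriv_conv (j : Fin d) {f g : PatternGroupoid L₀ → ℂ} (hg : HasCompactSupport g) :
    deriv j (conv f g) = conv (deriv j f) g + conv f (deriv j g) := by
  ext γ
  simp only [deriv, conv, Pi.add_apply]
  rw [← Summable.tsum_add, ← tsum_mul_left]
  · refine tsum_congr fun y => ?_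
    have h1 : ((quot γ.pattern γ.point y).point : Space d) = γ.point - y := rfl
    have h2 : ((mk γ.pattern y).point : Space d) = y := rfl
    rw [h1, h2, PiLp.sub_apply]
    push_cast
    ring
  · exact summable_of_hasFiniteSupport ((finite_support_mk hg γ.pattern).subset fun y hy =>
      right_ne_zero_of_mul hy)
  · exact summable_of_hasFiniteSupport ((finite_support_mk hg γ.pattern).subset fun y hy =>
      right_ne_zero_of_mul (right_ne_zero_of_mul hy))

/-! ### The convolution algebra -/

/-- The core `C_c(𝒢)` as a `*`-algebra with the convolution product, in place of the pointwise
product that `C_c(𝒢)` carries in Mathlib. -/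
def ConvAlgebra (L₀ : Delone.DeloneSet (Space d)) : Type := Core L₀

namespace ConvAlgebra

instance : AddCommGroup (ConvAlgebra L₀) := inferInstanceAs (AddCommGroup (Core L₀))

instance : Module ℂ (ConvAlgebra L₀) := inferInstanceAs (Module ℂ (Core L₀))

instance : FunLike (ConvAlgebra L₀) (PatternGroupoid L₀) ℂ :=
  inferInstanceAs (FunLike (Core L₀) (PatternGroupoid L₀) ℂ)

theorem continuous (f : ConvAlgebra L₀) : Continuous f :=
  (show Core L₀ from f).toContinuousMap.continuous

theorem hasCompactSupport (f : ConvAlgebra L₀) : HasCompactSupport f :=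
  CompactlySupportedContinuousMap.hasCompactSupport' f

/-- A continuous function of compact support as an element of the convolution algebra. -/
def of (f : PatternGroupoid L₀ → ℂ) (hf : Continuous f) (hc : HasCompactSupport f) :
    ConvAlgebra L₀ := (⟨⟨f, hf⟩, hc⟩ : Core L₀)

@[simp] theorem coe_of (f : PatternGroupoid L₀ → ℂ) (hf : Continuous f) (hc : HasCompactSupport f) :
    ⇑(of f hf hc) = f := rfl

instance : Mul (ConvAlgebra L₀) := ⟨fun f g => of (conv f g)
  (continuous_conv f.continuous g.continuous g.hasCompactSupport)
  (hasCompactSupport_conv f.hasCompactSupport g.hasCompactSupport)⟩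

@[simp] theorem coe_mul (f g : ConvAlgebra L₀) : ⇑(f * g) = conv f g := rfl

@[simp] theorem coe_add (f g : ConvAlgebra L₀) : ⇑(f + g) = ⇑f + ⇑g := rfl

@[simp] theorem coe_smul (c : ℂ) (f : ConvAlgebra L₀) : ⇑(c • f) = c • ⇑f := rfl

@[simp] theorem coe_zero : ⇑(0 : ConvAlgebra L₀) = 0 := rfl

instance : NonUnitalRing (ConvAlgebra L₀) where
  __ := (inferInstance : AddCommGroup (ConvAlgebra L₀))
  left_distrib _ g h := DFunLike.coe_injective (conv_add g.hasCompactSupport h.hasCompactSupport)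
  right_distrib _ _ h := DFunLike.coe_injective (add_conv h.hasCompactSupport)
  zero_mul f := DFunLike.coe_injective (zero_conv f)
  mul_zero f := DFunLike.coe_injective (conv_zero f)
  mul_assoc f _ h := DFunLike.coe_injective (conv_assoc f.hasCompactSupport h.hasCompactSupport)

instance : IsScalarTower ℂ (ConvAlgebra L₀) (ConvAlgebra L₀) :=
  ⟨fun c f g => DFunLike.coe_injective (smul_conv c f g)⟩

instance : SMulCommClass ℂ (ConvAlgebra L₀) (ConvAlgebra L₀) :=
  ⟨fun c f g => DFunLike.coe_injective (conv_smul c f g).symm⟩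

instance : StarRing (ConvAlgebra L₀) where
  star f := of (invol f) (continuous_invol f.continuous)
    (hasCompactSupport_invol f.hasCompactSupport)
  star_involutive f := DFunLike.coe_injective (invol_invol f)
  star_mul f g := DFunLike.coe_injective (invol_conv f g)
  star_add f g := DFunLike.coe_injective (by ext γ; exact star_add (f (inv γ)) (g (inv γ)))

@[simp] theorem coe_star (f : ConvAlgebra L₀) : ⇑(star f) = invol f := rfl

instance : StarModule ℂ (ConvAlgebra L₀) :=
  ⟨fun c f => DFunLike.coe_injective (by ext γ; exact star_smul c (f (inv γ)))⟩

/-- The derivation `∂ⱼ`. -/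
def der (j : Fin d) : ConvAlgebra L₀ →ₗ[ℂ] ConvAlgebra L₀ where
  toFun f := of (deriv j f) (continuous_deriv j f.continuous)
    (hasCompactSupport_deriv j f.hasCompactSupport)
  map_add' f g := DFunLike.coe_injective (by ext γ; exact mul_add _ (f γ) (g γ))
  map_smul' c f := DFunLike.coe_injective (by ext γ; exact mul_left_comm _ c (f γ))

@[simp] theorem coe_der (j : Fin d) (f : ConvAlgebra L₀) : ⇑(der j f) = deriv j f := rfl

theorem der_mul (j : Fin d) (f g : ConvAlgebra L₀) : der j (f * g) = der j f * g + f * der j g :=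
  DFunLike.coe_injective (deriv_conv j g.hasCompactSupport)

theorem der_comm (i j : Fin d) (f : ConvAlgebra L₀) : der i (der j f) = der j (der i f) :=
  DFunLike.coe_injective (by ext γ; exact mul_left_comm _ _ (f γ))

/-! ### The trace -/

/-- The `ℓ²`-norm squared of the restriction of `f` to the source fibre of `L`. -/
def fiberNormSq (f : ConvAlgebra L₀) (L : Transversal L₀) : ℝ := ∑' x : L.points, ‖f (mk L x)‖ ^ 2

theorem fiberNormSq_nonneg (f : ConvAlgebra L₀) (L : Transversal L₀) : 0 ≤ fiberNormSq f L :=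
  tsum_nonneg fun _ => by positivity

theorem star_mul_self_unit (f : ConvAlgebra L₀) (L : Transversal L₀) :
    (star f * f) (unit L) = fiberNormSq f L := by
  have h : unit L = quot L (origin L) (origin L) := (quot_origin L _).symm
  rw [h, coe_mul, conv_quot, fiberNormSq, Complex.ofReal_tsum]
  refine tsum_congr fun x => ?_
  rw [coe_star, invol_quot, quot_origin, ← starRingEnd_apply, Complex.conj_mul']
  push_cast
  rfl

theorem summable_norm_mk_sq (f : ConvAlgebra L₀) (L : Transversal L₀) :
    Summable fun x : L.points => ‖f (mk L x)‖ ^ 2 :=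
  summable_of_hasFiniteSupport ((finite_support_mk f.hasCompactSupport L).subset fun x hx => by
    simpa using hx)

variable (P : Measure (Transversal L₀))

theorem integrable_unit [IsProbabilityMeasure P] (f : ConvAlgebra L₀) :
    Integrable (fun L => f (unit L)) P := by
  obtain ⟨C, hC⟩ := f.hasCompactSupport.exists_bound_of_continuous f.continuous
  exact Integrable.of_bound (f.continuous.comp continuous_unit).aestronglyMeasurable C
    (Filter.Eventually.of_forall fun L => hC _)

theorem integrable_fiberNormSq [IsProbabilityMeasure P] (f : ConvAlgebra L₀) :
    Integrable (fiberNormSq f) P := by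
  have h := (integrable_unit P (star f * f)).re
  simpa only [star_mul_self_unit, RCLike.re_to_complex, Complex.ofReal_re] using h

theorem trace_star_mul_self (f : ConvAlgebra L₀) :
    trace P (star f * f : ConvAlgebra L₀) = ((∫ L, fiberNormSq f L ∂P : ℝ) : ℂ) := by
  simp only [trace, star_mul_self_unit]
  exact integral_ofReal

theorem trace_add [IsProbabilityMeasure P] (f g : ConvAlgebra L₀) :
    trace P (f + g : ConvAlgebra L₀) = trace P f + trace P g :=
  integral_add (integrable_unit P f) (integrable_unit P g)

theorem trace_smul (c : ℂ) (f : ConvAlgebra L₀) :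
    trace P (c • f : ConvAlgebra L₀) = c * trace P f :=
  integral_const_mul c _

theorem trace_star (f : ConvAlgebra L₀) :
    trace P (star f : ConvAlgebra L₀) = star (trace P f) := by
  rw [trace, trace, ← starRingEnd_apply, ← integral_conj]
  refine integral_congr_ae (Filter.Eventually.of_forall fun L => ?_)
  have h : unit L = quot L (origin L) (origin L) := (quot_origin L _).symm
  change star f (unit L) = star (f (unit L))
  rw [h, coe_star, invol_quot]

variable {P} [IsProbabilityMeasure P]

/-- Invariance of the measure under inversion gives `τ(f* f) = τ(f f*)`, as both sides are integrals
of the fibrewise `ℓ²`-norms, of `f` and of `f ∘ inv` respectively. -/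
theorem trace_star_mul_self_comm (hP : IsGroupoidInvariant P) (f : ConvAlgebra L₀) :
    trace P (star f * f : ConvAlgebra L₀) = trace P (f * star f : ConvAlgebra L₀) := by
  have key : ∀ g : ConvAlgebra L₀, ∫ L, fiberNormSq g L ∂P =
      (∫⁻ L, ∑' x : L.points, ENNReal.ofReal (‖g (mk L x)‖ ^ 2) ∂P).toReal := by
    intro g
    rw [integral_eq_lintegral_of_nonneg_ae (Filter.Eventually.of_forall (fiberNormSq_nonneg g))
      (integrable_fiberNormSq P g).aestronglyMeasurable]
    congr 1
    refine lintegral_congr fun L => ?_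
    exact ENNReal.ofReal_tsum_of_nonneg (fun _ => by positivity) (summable_norm_mk_sq g L)
  have h1 : f * star f = star (star f) * star f := by rw [star_star]
  rw [h1, trace_star_mul_self, trace_star_mul_self, key, key,
    hP (fun γ => ENNReal.ofReal (‖f γ‖ ^ 2)) (by
      exact (ENNReal.continuous_ofReal.comp (f.continuous.norm.pow 2)).measurable)]
  simp only [coe_star, invol_apply, norm_star]

theorem trace_mul_comm (hP : IsGroupoidInvariant P) (f g : ConvAlgebra L₀) :
    trace P (f * g : ConvAlgebra L₀) = trace P (g * f : ConvAlgebra L₀) := by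
  -- polarization of the identity `τ(a* a) = τ(a a*)`
  obtain ⟨a, rfl⟩ : ∃ a, f = star a := ⟨star f, (star_star f).symm⟩
  have h1 := trace_star_mul_self_comm hP (a + g)
  have h2 := trace_star_mul_self_comm hP (a + Complex.I • g)
  have h3 := trace_star_mul_self_comm hP a
  have h4 := trace_star_mul_self_comm hP g
  have hI : star Complex.I = -Complex.I := Complex.conj_I
  simp only [star_add, star_smul, add_mul, mul_add, smul_mul_assoc, mul_smul_comm,
    trace_add, trace_smul, hI] at h1 h2
  have h5 : Complex.I * Complex.I = -1 := Complex.I_mul_I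
  linear_combination (1 / 2) * h1 - (1 / 2) * Complex.I * h2 + (1 / 2) * (Complex.I - 1) * h3 +
    (1 / 2) * (Complex.I - 1) * h4 +
    (1 / 2) * (trace P (star a * g : ConvAlgebra L₀) - trace P (g * star a : ConvAlgebra L₀) +
      trace P (a * star g : ConvAlgebra L₀) - trace P (star g * a : ConvAlgebra L₀) +
      Complex.I * (trace P (g * star g : ConvAlgebra L₀) -
        trace P (star g * g : ConvAlgebra L₀))) * h5

/-! ### Boundedness of the left convolution -/

/-- The `ℓ¹`-norms on the source fibres are bounded, as they form a continuous function of compact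
support. -/
theorem exists_fiber_sum_le (f : ConvAlgebra L₀) :
    ∃ C : ℝ, 0 ≤ C ∧ ∀ L : Transversal L₀, ∑' x : L.points, ‖f (mk L x)‖ ≤ C := by
  have h1 := continuous_tsum_fiber (isLocalHomeomorph_pattern (L₀ := L₀)) continuous_id
    f.hasCompactSupport.isCompact (F := fun q : Transversal L₀ × PatternGroupoid L₀ => ‖f q.2‖)
    (f.continuous.norm.comp continuous_snd).continuousOn
    (fun _ γ hγ => by simp [apply_eq_zero_of_notMem_tsupport hγ])
  have h2 : Continuous fun L : Transversal L₀ => ∑' x : L.points, ‖f (mk L x)‖ :=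
    h1.congr fun L => (tsum_points_eq L fun γ => ‖f γ‖).symm
  have h3 : HasCompactSupport fun L : Transversal L₀ => ∑' x : L.points, ‖f (mk L x)‖ := by
    refine HasCompactSupport.intro (f.hasCompactSupport.isCompact.image continuous_pattern)
      fun L hL => ?_
    have h0 : ∀ x : L.points, f (mk L x) = 0 := fun x => by
      by_contra h
      exact hL ⟨_, subset_tsupport f h, rfl⟩
    simp [h0]
  obtain ⟨C, hC⟩ := h3.exists_bound_of_continuous h2
  refine ⟨|C|, abs_nonneg C, fun L => ?_⟩
  exact (le_abs_self _).trans ((hC L).trans (le_abs_self C))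

/-- Schur's test: a bound for the row and column sums of a kernel bounds it on `ℓ²`. -/
theorem schur_test {ι κ : Type*} (X : Finset ι) (Y : Finset κ) (m : ι → κ → ℂ) (v : κ → ℂ)
    {a b : ℝ} (ha : 0 ≤ a) (hrow : ∀ x ∈ X, ∑ y ∈ Y, ‖m x y‖ ≤ a)
    (hcol : ∀ y ∈ Y, ∑ x ∈ X, ‖m x y‖ ≤ b) :
    ∑ x ∈ X, ‖∑ y ∈ Y, m x y * v y‖ ^ 2 ≤ a * b * ∑ y ∈ Y, ‖v y‖ ^ 2 := by
  have h1 : ∀ x ∈ X, ‖∑ y ∈ Y, m x y * v y‖ ^ 2 ≤ a * ∑ y ∈ Y, ‖m x y‖ * ‖v y‖ ^ 2 := by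
    intro x hx
    have h2 : ‖∑ y ∈ Y, m x y * v y‖ ≤ ∑ y ∈ Y, ‖m x y‖ * ‖v y‖ :=
      (norm_sum_le _ _).trans_eq (Finset.sum_congr rfl fun y _ => norm_mul _ _)
    have h3 : (∑ y ∈ Y, ‖m x y‖ * ‖v y‖) ^ 2 ≤
        (∑ y ∈ Y, ‖m x y‖) * ∑ y ∈ Y, ‖m x y‖ * ‖v y‖ ^ 2 :=
      Finset.sum_sq_le_sum_mul_sum_of_sq_le_mul _ (fun _ _ => norm_nonneg _)
        (fun _ _ => by positivity) fun y _ => le_of_eq (by ring)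
    refine (pow_le_pow_left₀ (norm_nonneg _) h2 2).trans (h3.trans ?_)
    exact mul_le_mul_of_nonneg_right (hrow x hx) (Finset.sum_nonneg fun _ _ => by positivity)
  calc ∑ x ∈ X, ‖∑ y ∈ Y, m x y * v y‖ ^ 2
      ≤ ∑ x ∈ X, a * ∑ y ∈ Y, ‖m x y‖ * ‖v y‖ ^ 2 := Finset.sum_le_sum h1
    _ = a * ∑ y ∈ Y, (∑ x ∈ X, ‖m x y‖) * ‖v y‖ ^ 2 := by
      rw [← Finset.mul_sum, Finset.sum_comm]
      simp only [Finset.sum_mul]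
    _ ≤ a * ∑ y ∈ Y, b * ‖v y‖ ^ 2 := by
      refine mul_le_mul_of_nonneg_left (Finset.sum_le_sum fun y hy => ?_) ha
      exact mul_le_mul_of_nonneg_right (hcol y hy) (by positivity)
    _ = _ := by rw [← Finset.mul_sum, mul_assoc]

theorem exists_fiberNormSq_mul_le (f : ConvAlgebra L₀) :
    ∃ C : ℝ, 0 ≤ C ∧ ∀ (g : ConvAlgebra L₀) (L : Transversal L₀),
      fiberNormSq (f * g) L ≤ C ^ 2 * fiberNormSq g L := by
  obtain ⟨b, hb0, hb⟩ := exists_fiber_sum_le f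
  obtain ⟨a, ha0, ha⟩ := exists_fiber_sum_le (star f)
  refine ⟨√(a * b), Real.sqrt_nonneg _, fun g L => ?_⟩
  rw [Real.sq_sqrt (mul_nonneg ha0 hb0)]
  have hX := finite_support_mk (f * g).hasCompactSupport L
  have hY := finite_support_mk g.hasCompactSupport L
  have hY0 : ∀ y ∉ hY.toFinset, g (mk L y) = 0 := fun y hy => by simpa using hy
  have hfin : ∀ x y : L.points, ‖star f (quot L y x)‖ = ‖f (quot L x y)‖ := fun x y => by
    rw [coe_star, invol_quot, norm_star]
  have hsum : ∀ (h : ConvAlgebra L₀) (X : Finset L.points) (y : L.points),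
      ∑ x ∈ X, ‖h (quot L x y)‖ ≤ ∑' z : (L.shift y).points, ‖h (mk (L.shift y) z)‖ := by
    intro h X y
    rw [← (shiftEquiv L y).tsum_eq fun z => ‖h (mk (L.shift y) z)‖]
    simp only [mk_shiftEquiv]
    have hs : Summable fun x => ‖h (quot L x y)‖ := summable_of_hasFiniteSupport
      ((finite_support_quot h.hasCompactSupport L y).subset fun x hx => by simpa using hx)
    exact hs.sum_le_tsum X fun _ _ => norm_nonneg _
  have h1 := schur_test hX.toFinset hY.toFinset (fun x y => f (quot L x y)) (fun y => g (mk L y))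
    (b := b) ha0
    (fun x _ => by
      simp only [← hfin]
      exact (hsum (star f) _ x).trans (ha _))
    (fun y _ => (hsum f _ y).trans (hb _))
  rw [fiberNormSq, fiberNormSq, tsum_eq_sum (s := hX.toFinset), tsum_eq_sum (s := hY.toFinset)]
  · refine le_of_eq_of_le (Finset.sum_congr rfl fun x _ => ?_) h1
    have h2 : (f * g) (mk L x) = ∑ y ∈ hY.toFinset, f (quot L x y) * g (mk L y) :=
      (show (f * g) (mk L x) = ∑' y : L.points, f (quot L x y) * g (mk L y) from rfl).trans
        (tsum_eq_sum fun y hy => by rw [hY0 y hy, mul_zero])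
    rw [h2]
  · intro y hy
    rw [hY0 y hy]
    simp
  · intro x hx
    have : (f * g) (mk L x) = 0 := by simpa using hx
    rw [this]
    simp

/-- The trace of an invariant probability measure. -/
def positiveTrace (hP : IsGroupoidInvariant P) : PositiveTrace (ConvAlgebra L₀) where
  toLinearMap :=
    { toFun := fun f => trace P f
      map_add' := trace_add P
      map_smul' := trace_smul P }
  trace_mul_comm := trace_mul_comm hP
  trace_star := trace_star P
  trace_nonneg f := by
    change 0 ≤ (trace P (star f * f : ConvAlgebra L₀)).re
    rw [trace_star_mul_self, Complex.ofReal_re]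
    exact integral_nonneg (fiberNormSq_nonneg f)
  bounded f := by
    obtain ⟨C, hC, h⟩ := exists_fiberNormSq_mul_le f
    refine ⟨C, hC, fun g => ?_⟩
    change (trace P (star (f * g) * (f * g) : ConvAlgebra L₀)).re ≤
      C ^ 2 * (trace P (star g * g : ConvAlgebra L₀)).re
    rw [trace_star_mul_self, trace_star_mul_self, Complex.ofReal_re, Complex.ofReal_re,
      ← integral_const_mul]
    exact integral_mono (integrable_fiberNormSq P _)
      ((integrable_fiberNormSq P g).const_mul _) (h g)

end ConvAlgebra

namespace ConvAlgebra

/-! ### The norms and the cocycle in the convolution algebra -/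

variable {P : Measure (Transversal L₀)}

theorem convProd_map {l : List (ConvAlgebra L₀)} (hl : l ≠ []) :
    convProd (l.map fun f : ConvAlgebra L₀ => ⇑f) =
      ⇑(l.map (Unitization.inr : ConvAlgebra L₀ → Unitization ℂ (ConvAlgebra L₀))).prod.snd := by
  induction l with
  | nil => exact absurd rfl hl
  | cons f l ih =>
    have h1 : convProd ((f :: l).map fun f : ConvAlgebra L₀ => ⇑f) =
        conv f (convProd (l.map fun f : ConvAlgebra L₀ => ⇑f)) := rfl
    by_cases h : l = []
    · subst h
      rw [h1, List.map_nil, show convProd (L₀ := L₀) [] = convOne from rfl, conv_convOne]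
      simp
    · obtain ⟨g, hg⟩ := PositiveTrace.exists_inr_eq_prod h
      rw [h1, ih h, List.map_cons, List.prod_cons, hg, ← Unitization.inr_mul]
      rfl

theorem cocycle_eq_sum (f : Fin (d + 1) → ConvAlgebra L₀) :
    cocycle P (fun i => ⇑(f i)) = cocycleConst d * ∑ σ : Equiv.Perm (Fin d),
      ((Equiv.Perm.sign σ : ℤ) : ℂ) * trace P
        (convProd ((f 0 :: List.ofFn fun j : Fin d => der (σ j) (f j.succ)).map
          fun f : ConvAlgebra L₀ => ⇑f)) := by
  simp only [cocycle, List.map_cons, List.map_ofFn]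
  rfl

variable [IsProbabilityMeasure P]

theorem trace_convProd (hP : IsGroupoidInvariant P) {l : List (ConvAlgebra L₀)} (hl : l ≠ []) :
    trace P (convProd (l.map fun f : ConvAlgebra L₀ => ⇑f)) = (positiveTrace hP).word l := by
  rw [convProd_map hl]
  rfl

theorem evenNorm_eq (hP : IsGroupoidInvariant P) {k : ℕ} (hk : 0 < k) (f : ConvAlgebra L₀) :
    evenNorm P k f = (positiveTrace hP).schatten k f := by
  have h : List.replicate k (conv (invol f) f) =
      (List.replicate k (star f * f)).map fun f : ConvAlgebra L₀ => ⇑f := by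
    rw [List.map_replicate]
    rfl
  rw [evenNorm, h, trace_convProd hP (by simpa using hk.ne'), PositiveTrace.word,
    List.map_replicate, List.prod_replicate]
  rfl

theorem inftyNorm_eq (hP : IsGroupoidInvariant P) (f : ConvAlgebra L₀) :
    inftyNorm P f = (positiveTrace hP).opNorm f := by
  have h : ∀ g : ConvAlgebra L₀, evenNorm P 1 (conv f g) = (positiveTrace hP).schatten 1 (f * g) :=
    fun g => evenNorm_eq hP one_pos (f * g)
  rw [inftyNorm, PositiveTrace.opNorm]
  congr 1
  ext c
  refine and_congr_right fun _ => forall_congr' fun g : ConvAlgebra L₀ => ?_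
  rw [← h, ← evenNorm_eq hP one_pos]
  rfl

/-- The part of the Sobolev norm that measures the derivatives. -/
def derNorm (hP : IsGroupoidInvariant P) (f : ConvAlgebra L₀) : ℝ :=
  ∑ j : Fin d, (positiveTrace hP).schatten (d / 2) (der j f)

theorem sobolevNorm_eq (hP : IsGroupoidInvariant P) (hd : 0 < d / 2) (f : ConvAlgebra L₀) :
    sobolevNorm P f = (positiveTrace hP).opNorm f + derNorm hP f := by
  rw [sobolevNorm, inftyNorm_eq hP, derNorm]
  congr 1
  exact Finset.sum_congr rfl fun j _ => evenNorm_eq hP hd (der j f)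

variable (hP : IsGroupoidInvariant P)

theorem derNorm_nonneg (hd : 0 < d / 2) (f : ConvAlgebra L₀) : 0 ≤ derNorm hP f :=
  Finset.sum_nonneg fun _ _ => (positiveTrace hP).schatten_nonneg hd _

theorem schatten_der_le (hd : 0 < d / 2) (j : Fin d) (f : ConvAlgebra L₀) :
    (positiveTrace hP).schatten (d / 2) (der j f) ≤ derNorm hP f :=
  Finset.single_le_sum (f := fun j => (positiveTrace hP).schatten (d / 2) (der j f))
    (fun _ _ => (positiveTrace hP).schatten_nonneg hd _) (Finset.mem_univ j)

theorem derNorm_add_le (hd : 0 < d / 2) (f g : ConvAlgebra L₀) :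
    derNorm hP (f + g) ≤ derNorm hP f + derNorm hP g := by
  rw [derNorm, derNorm, derNorm, ← Finset.sum_add_distrib]
  refine Finset.sum_le_sum fun j _ => ?_
  rw [map_add]
  exact (positiveTrace hP).schatten_add_le hd _ _

theorem derNorm_smul (hd : 0 < d / 2) (c : ℂ) (f : ConvAlgebra L₀) :
    derNorm hP (c • f) = ‖c‖ * derNorm hP f := by
  rw [derNorm, derNorm, Finset.mul_sum]
  refine Finset.sum_congr rfl fun j _ => ?_
  rw [map_smul, (positiveTrace hP).schatten_smul hd]

theorem derNorm_mul_le (hd : 0 < d / 2) (f g : ConvAlgebra L₀) :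
    derNorm hP (f * g) ≤
      derNorm hP f * (positiveTrace hP).opNorm g + (positiveTrace hP).opNorm f * derNorm hP g := by
  rw [derNorm, derNorm, derNorm, Finset.sum_mul, Finset.mul_sum, ← Finset.sum_add_distrib]
  refine Finset.sum_le_sum fun j _ => ?_
  rw [der_mul]
  exact ((positiveTrace hP).schatten_add_le hd _ _).trans
    (add_le_add ((positiveTrace hP).schatten_mul_le' hd _ _)
      ((positiveTrace hP).schatten_mul_le hd _ _))

/-- The norm of `L^∞` as a seminorm. -/
def opSeminorm : Seminorm ℂ (ConvAlgebra L₀) :=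
  Seminorm.ofSMulLE (positiveTrace hP).opNorm
    (le_antisymm (by simpa using (positiveTrace hP).opNorm_smul_le 0 0)
      ((positiveTrace hP).opNorm_nonneg 0))
    (positiveTrace hP).opNorm_add_le (positiveTrace hP).opNorm_smul_le

theorem opSeminorm_apply (f : ConvAlgebra L₀) :
    opSeminorm hP f = (positiveTrace hP).opNorm f := rfl

/-- The derivation `∂ⱼ` on the unitization. -/
def derExt (j : Fin d) :
    Unitization ℂ (ConvAlgebra L₀) →ₗ[ℂ] Unitization ℂ (ConvAlgebra L₀) :=
  Unitization.inrHom ℂ ℂ (ConvAlgebra L₀) ∘ₗ der j ∘ₗ Unitization.sndHom ℂ ℂ (ConvAlgebra L₀)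

theorem derExt_apply (j : Fin d) (x : Unitization ℂ (ConvAlgebra L₀)) :
    derExt j x = (der j x.snd : Unitization ℂ (ConvAlgebra L₀)) := rfl

theorem derExt_mul (j : Fin d) (x y : Unitization ℂ (ConvAlgebra L₀)) :
    derExt j (x * y) = derExt j x * y + x * derExt j y := by
  simp only [derExt_apply, Unitization.snd_mul, map_add, map_smul, der_mul]
  ext
  · simp
  · simp only [Unitization.snd_add, Unitization.snd_mul, Unitization.snd_inr,
      Unitization.fst_inr, zero_smul, add_zero, zero_add]
    abel

theorem cocycle_eq_altSum (f : Fin (d + 1) → ConvAlgebra L₀) :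
    cocycle P (fun i => ⇑(f i)) = cocycleConst d * altSum (positiveTrace hP).ext derExt
      (fun i => (f i : Unitization ℂ (ConvAlgebra L₀))) := by
  rw [cocycle_eq_sum, altSum]
  congr 1
  refine Finset.sum_congr rfl fun σ _ => ?_
  rw [trace_convProd hP (List.cons_ne_nil _ _), PositiveTrace.word, List.map_cons, List.prod_cons,
    List.map_ofFn]
  rfl

theorem cocycle_rotate (hP : IsGroupoidInvariant P) (hd : Even d) (hd0 : 0 < d)
    (f : Fin (d + 1) → ConvAlgebra L₀) :
    cocycle P (fun i => ⇑(f (i + 1))) = cocycle P (fun i => ⇑(f i)) := by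
  rw [cocycle_eq_altSum hP f, cocycle_eq_altSum hP fun i => f (i + 1)]
  have h1 : ∀ (j : Fin d) (x : Unitization ℂ (ConvAlgebra L₀)),
      (positiveTrace hP).ext (derExt j x) = 0 := by
    intro j x
    rw [derExt_apply, PositiveTrace.ext_inr]
    change trace P (der j x.snd) = 0
    have h : ∀ L : Transversal L₀, der j x.snd (unit L) = 0 := by
      intro L
      have : ((unit L).point : Space d) = 0 := rfl
      simp [deriv, this]
    simp only [trace, h, integral_zero]
  have h2 : ∀ (i j : Fin d) (x : Unitization ℂ (ConvAlgebra L₀)),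
      derExt i (derExt j x) = derExt j (derExt i x) := by
    intro i j x
    simp only [derExt_apply, Unitization.snd_inr, der_comm i j]
  have h3 := altSum_rotate hd hd0 (positiveTrace hP).ext_mul_comm derExt_mul h2 h1
    fun i => (f i : Unitization ℂ (ConvAlgebra L₀))
  exact congrArg (cocycleConst d * ·) h3

theorem norm_cocycle_le (hd : Even d) (hd0 : 0 < d) (f : Fin (d + 1) → ConvAlgebra L₀) :
    ‖cocycle P (fun i => ⇑(f i))‖ ≤ ‖cocycleConst d‖ * (d.factorial : ℝ) *
      ((positiveTrace hP).opNorm (f 0) * ∏ j : Fin d, derNorm hP (f j.succ)) := by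
  have hd2 : 0 < d / 2 := by
    obtain ⟨n, rfl⟩ := hd
    omega
  rw [cocycle_eq_sum, norm_mul, mul_assoc]
  refine mul_le_mul_of_nonneg_left ?_ (norm_nonneg _)
  refine (norm_sum_le _ _).trans ?_
  have hcard : ((d.factorial : ℕ) : ℝ) = (Finset.univ : Finset (Equiv.Perm (Fin d))).card := by
    rw [Finset.card_univ, Fintype.card_perm, Fintype.card_fin]
  rw [hcard, ← nsmul_eq_mul]
  refine Finset.sum_le_card_nsmul _ _ _ fun σ _ => ?_
  have hsign : ‖((Equiv.Perm.sign σ : ℤ) : ℂ)‖ = 1 := by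
    rcases Int.units_eq_one_or (Equiv.Perm.sign σ) with h | h <;> simp [h]
  rw [norm_mul, hsign, one_mul, trace_convProd hP (List.cons_ne_nil _ _)]
  refine ((positiveTrace hP).norm_word_cons_le hd2 _ ?_).trans ?_
  · rw [List.length_ofFn, Nat.two_mul_div_two_of_even hd]
  · refine mul_le_mul_of_nonneg_left ?_ ((positiveTrace hP).opNorm_nonneg _)
    rw [List.map_ofFn, List.prod_ofFn]
    exact Finset.prod_le_prod (fun _ _ => (positiveTrace hP).schatten_nonneg hd2 _)
      fun j _ => schatten_der_le hP hd2 _ _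

/-- The cocycle as a multilinear map. -/
def cocycleMultilinear : MultilinearMap ℂ (fun _ : Fin (d + 1) => ConvAlgebra L₀) ℂ :=
  cocycleConst d • ∑ σ : Equiv.Perm (Fin d), ((Equiv.Perm.sign σ : ℤ) : ℂ) •
    (positiveTrace hP).ext.compMultilinearMap
      ((MultilinearMap.mkPiAlgebraFin ℂ (d + 1) (Unitization ℂ (ConvAlgebra L₀))).compLinearMap
        (Fin.cases (Unitization.inrHom ℂ ℂ (ConvAlgebra L₀))
          fun j => Unitization.inrHom ℂ ℂ (ConvAlgebra L₀) ∘ₗ der (σ j)))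

theorem cocycleMultilinear_apply (f : Fin (d + 1) → ConvAlgebra L₀) :
    cocycleMultilinear hP f = cocycle P (fun i => ⇑(f i)) := by
  rw [cocycle_eq_altSum hP]
  simp only [cocycleMultilinear, altSum, smul_apply, sum_apply,
    smul_eq_mul, LinearMap.compMultilinearMap_apply, MultilinearMap.compLinearMap_apply,
    MultilinearMap.mkPiAlgebraFin_apply, List.ofFn_succ, List.prod_cons]
  rfl

end ConvAlgebra

open ConvAlgebra UniformSpace

variable {P : Measure (Transversal L₀)}

/-! ### The Sobolev space -/

theorem div_two_pos_of_even (hd : Even d) (hd0 : 0 < d) : 0 < d / 2 := by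
  obtain ⟨n, rfl⟩ := hd
  omega

/-- The elements of the Sobolev core as elements of the convolution algebra. -/
def toAlgebra (P : Measure (Transversal L₀)) : SobolevCore P →ₗ[ℂ] ConvAlgebra L₀ where
  toFun f := f
  map_add' _ _ := rfl
  map_smul' _ _ := rfl

/-- The elements of the convolution algebra as elements of the Sobolev core. -/
def ofAlgebra (P : Measure (Transversal L₀)) : ConvAlgebra L₀ →ₗ[ℂ] SobolevCore P where
  toFun f := f
  map_add' _ _ := rfl
  map_smul' _ _ := rfl

theorem toAlgebra_ofAlgebra (f : ConvAlgebra L₀) : toAlgebra P (ofAlgebra P f) = f := rfl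

theorem continuous_sobolevInftyNorm : Continuous (sobolevInftyNorm P) :=
  Completion.continuous_extension

/-- The extension to the Sobolev space of the part of the norm that measures the derivatives. -/
def sobolevDerNorm (P : Measure (Transversal L₀)) (u : SobolevSpace P) : ℝ :=
  ‖u‖ - sobolevInftyNorm P u

theorem continuous_sobolevDerNorm : Continuous (sobolevDerNorm P) :=
  continuous_norm.sub continuous_sobolevInftyNorm

theorem sobolev_tuple_induction {p : (Fin (d + 1) → SobolevSpace P) → Prop}
    (hp : IsClosed {u | p u})
    (h : ∀ f : Fin (d + 1) → SobolevCore P, p fun i => (f i : SobolevSpace P))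
    (u : Fin (d + 1) → SobolevSpace P) : p u :=
  isClosed_property (DenseRange.piMap fun _ => Completion.denseRange_coe) hp h u

section Norm

variable [IsProbabilityMeasure P] (hP : IsGroupoidInvariant P)

/-- The formula for the Sobolev norm defines a seminorm, so that it is the norm of the core. -/
theorem norm_sobolevCore (hd : 0 < d / 2) (f : SobolevCore P) :
    ‖f‖ = (positiveTrace hP).opNorm (toAlgebra P f) + derNorm hP (toAlgebra P f) := by
  have h : ∃ p : Seminorm ℂ (Core L₀), ∀ f : Core L₀, p f = sobolevNorm P f := by
    refine ⟨Seminorm.ofSMulLE (fun f : Core L₀ => sobolevNorm P f) ?_ ?_ ?_, fun _ => rfl⟩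
    · change sobolevNorm P (0 : ConvAlgebra L₀) = 0
      rw [sobolevNorm_eq hP hd, ← opSeminorm_apply, map_zero, zero_add]
      simpa using derNorm_smul hP hd 0 0
    · intro (f : ConvAlgebra L₀) (g : ConvAlgebra L₀)
      change sobolevNorm P ⇑(f + g) ≤ sobolevNorm P ⇑f + sobolevNorm P ⇑g
      rw [sobolevNorm_eq hP hd, sobolevNorm_eq hP hd, sobolevNorm_eq hP hd, add_add_add_comm]
      exact add_le_add ((positiveTrace hP).opNorm_add_le _ _) (derNorm_add_le hP hd _ _)
    · intro c (f : ConvAlgebra L₀)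
      change sobolevNorm P ⇑(c • f) ≤ ‖c‖ * sobolevNorm P ⇑f
      rw [sobolevNorm_eq hP hd, sobolevNorm_eq hP hd, mul_add]
      exact add_le_add ((positiveTrace hP).opNorm_smul_le _ _) (derNorm_smul hP hd _ _).le
  rw [← sobolevNorm_eq hP hd]
  change sobolevSeminorm P f = _
  rw [sobolevSeminorm, dif_pos h]
  exact h.choose_spec f

theorem opNorm_le_norm (hd : 0 < d / 2) (f : SobolevCore P) :
    (positiveTrace hP).opNorm (toAlgebra P f) ≤ ‖f‖ := by
  rw [norm_sobolevCore hP hd]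
  exact le_add_of_nonneg_right (derNorm_nonneg hP hd _)

theorem derNorm_le_norm (hd : 0 < d / 2) (f : SobolevCore P) :
    derNorm hP (toAlgebra P f) ≤ ‖f‖ := by
  rw [norm_sobolevCore hP hd]
  exact le_add_of_nonneg_left ((positiveTrace hP).opNorm_nonneg _)

theorem uniformContinuous_inftyNorm (hP : IsGroupoidInvariant P) (hd : 0 < d / 2) :
    UniformContinuous fun f : SobolevCore P => inftyNorm P (show Core L₀ from f) := by
  refine LipschitzWith.uniformContinuous (K := 1) (LipschitzWith.mk_one fun f g => ?_)
  change |inftyNorm P (toAlgebra P f) - inftyNorm P (toAlgebra P g)| ≤ dist f g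
  rw [inftyNorm_eq hP, inftyNorm_eq hP, dist_eq_norm, ← opSeminorm_apply, ← opSeminorm_apply]
  refine (abs_sub_map_le_sub (opSeminorm hP) _ _).trans ?_
  rw [← map_sub]
  exact opNorm_le_norm hP hd _

theorem sobolevInftyNorm_coe (hd : 0 < d / 2) (f : SobolevCore P) :
    sobolevInftyNorm P (f : SobolevSpace P) = (positiveTrace hP).opNorm (toAlgebra P f) :=
  (Completion.extension_coe (uniformContinuous_inftyNorm hP hd) f).trans
    (inftyNorm_eq hP (toAlgebra P f))

theorem sobolevDerNorm_coe (hd : 0 < d / 2) (f : SobolevCore P) :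
    sobolevDerNorm P (f : SobolevSpace P) = derNorm hP (toAlgebra P f) := by
  rw [sobolevDerNorm, sobolevInftyNorm_coe hP hd, Completion.norm_coe, norm_sobolevCore hP hd,
    add_sub_cancel_left]

theorem sobolevDerNorm_nonneg (hP : IsGroupoidInvariant P) (hd : 0 < d / 2)
    (u : SobolevSpace P) : 0 ≤ sobolevDerNorm P u := by
  induction u using Completion.induction_on with
  | hp => exact isClosed_le continuous_const continuous_sobolevDerNorm
  | ih f =>
    rw [sobolevDerNorm_coe hP hd]
    exact derNorm_nonneg hP hd _

theorem sobolevInftyNorm_nonneg (hP : IsGroupoidInvariant P) (hd : 0 < d / 2)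
    (u : SobolevSpace P) : 0 ≤ sobolevInftyNorm P u := by
  induction u using Completion.induction_on with
  | hp => exact isClosed_le continuous_const continuous_sobolevInftyNorm
  | ih f =>
    rw [sobolevInftyNorm_coe hP hd]
    exact (positiveTrace hP).opNorm_nonneg _

end Norm

variable [IsProbabilityMeasure P]

/-! ### The product of the Sobolev space -/

theorem norm_ofAlgebra_mul_le (hP : IsGroupoidInvariant P) (hd : 0 < d / 2) (f g : SobolevCore P) :
    ‖ofAlgebra P (toAlgebra P f * toAlgebra P g)‖ ≤ ‖f‖ * ‖g‖ := by
  rw [norm_sobolevCore hP hd, norm_sobolevCore hP hd, norm_sobolevCore hP hd, toAlgebra_ofAlgebra]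
  set a := toAlgebra P f
  set b := toAlgebra P g
  have h1 := (positiveTrace hP).opNorm_mul_le a b
  have h2 := derNorm_mul_le hP hd a b
  have h3 := mul_nonneg (derNorm_nonneg hP hd a) (derNorm_nonneg hP hd b)
  linarith

/-- The convolution product as a continuous bilinear map on the Sobolev core. -/
def coreMul (hP : IsGroupoidInvariant P) (hd : 0 < d / 2) :
    SobolevCore P →L[ℂ] SobolevCore P →L[ℂ] SobolevCore P :=
  LinearMap.mkContinuous₂ (LinearMap.mk₂ ℂ
    (fun f g => ofAlgebra P (toAlgebra P f * toAlgebra P g))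
    (fun f f' g => by simp only [map_add, add_mul])
    (fun c f g => by simp only [map_smul, smul_mul_assoc])
    (fun f g g' => by simp only [map_add, mul_add])
    (fun c f g => by simp only [map_smul, mul_smul_comm])) 1
    fun f g => by
      rw [one_mul]
      exact norm_ofAlgebra_mul_le hP hd f g

/-- The product of the Sobolev space. -/
def sobolevMul (hP : IsGroupoidInvariant P) (hd : 0 < d / 2) :
    SobolevSpace P →L[ℂ] SobolevSpace P →L[ℂ] SobolevSpace P :=
  extendCompletion (extendCompletion ∘L
    (ContinuousLinearMap.compL ℂ (SobolevCore P) (SobolevCore P) (SobolevSpace P)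
      Completion.toComplL) ∘L coreMul hP hd)

theorem sobolevMul_coe (hP : IsGroupoidInvariant P) (hd : 0 < d / 2) (f g : SobolevCore P) :
    sobolevMul hP hd (f : SobolevSpace P) (g : SobolevSpace P) =
      (ofAlgebra P (toAlgebra P f * toAlgebra P g) : SobolevSpace P) := by
  rw [sobolevMul, extendCompletion_coe]
  change extendCompletion _ (g : SobolevSpace P) = _
  rw [extendCompletion_coe]
  rfl

theorem sobolevMul_assoc (hP : IsGroupoidInvariant P) (hd : 0 < d / 2) (u v w : SobolevSpace P) :
    sobolevMul hP hd (sobolevMul hP hd u v) w = sobolevMul hP hd u (sobolevMul hP hd v w) := by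
  refine Completion.induction_on₃ u v w (isClosed_eq (by fun_prop) (by fun_prop)) fun f g h => ?_
  rw [sobolevMul_coe, sobolevMul_coe, sobolevMul_coe, sobolevMul_coe]
  simp only [toAlgebra_ofAlgebra, mul_assoc]

theorem norm_sobolevMul_le (hP : IsGroupoidInvariant P) (hd : 0 < d / 2) (u v : SobolevSpace P) :
    ‖sobolevMul hP hd u v‖ ≤ ‖u‖ * ‖v‖ := by
  refine Completion.induction_on₂ u v (isClosed_le (by fun_prop) (by fun_prop)) fun f g => ?_
  rw [sobolevMul_coe, Completion.norm_coe, Completion.norm_coe, Completion.norm_coe]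
  exact norm_ofAlgebra_mul_le hP hd f g

/-! ### The cocycle on the Sobolev space -/

/-- The constant in the estimate of the cocycle. -/
def cocycleBound (d : ℕ) : ℝ := ‖cocycleConst d‖ * (d.factorial : ℝ)

theorem cocycleBound_nonneg (d : ℕ) : 0 ≤ cocycleBound d :=
  mul_nonneg (norm_nonneg _) (Nat.cast_nonneg _)

theorem norm_cocycle_le_prod_norm (hP : IsGroupoidInvariant P) (hd : Even d) (hd0 : 0 < d)
    (f : Fin (d + 1) → SobolevCore P) :
    ‖cocycleMultilinear hP fun i => toAlgebra P (f i)‖ ≤ cocycleBound d * ∏ i, ‖f i‖ := by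
  have hd2 := div_two_pos_of_even hd hd0
  rw [cocycleMultilinear_apply]
  refine (norm_cocycle_le hP hd hd0 _).trans ?_
  refine mul_le_mul_of_nonneg_left ?_ (cocycleBound_nonneg d)
  rw [Fin.prod_univ_succ]
  exact mul_le_mul (opNorm_le_norm hP hd2 _)
    (Finset.prod_le_prod (fun _ _ => derNorm_nonneg hP hd2 _) fun j _ => derNorm_le_norm hP hd2 _)
    (Finset.prod_nonneg fun _ _ => derNorm_nonneg hP hd2 _) (norm_nonneg _)

theorem exists_sobolev_cocycle (hP : IsGroupoidInvariant P) (hd : Even d) (hd0 : 0 < d) :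
    ∃ S : ContinuousMultilinearMap ℂ (fun _ : Fin (d + 1) => SobolevSpace P) ℂ,
      ∀ f : Fin (d + 1) → SobolevCore P, S (fun i => (f i : SobolevSpace P)) =
        cocycle P (fun i => ⇑(toAlgebra P (f i))) := by
  obtain ⟨S, hS⟩ := exists_extend_multilinear (MultilinearMap.mkContinuous
    ((cocycleMultilinear hP).compLinearMap fun _ => toAlgebra P) (cocycleBound d)
    (norm_cocycle_le_prod_norm hP hd hd0))
  refine ⟨S, fun f => (hS f).trans ?_⟩
  exact cocycleMultilinear_apply hP _

section Estimate

variable {S : ContinuousMultilinearMap ℂ (fun _ : Fin (d + 1) => SobolevSpace P) ℂ}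

theorem sobolev_cocycle_rotate (hP : IsGroupoidInvariant P) (hd : Even d) (hd0 : 0 < d)
    (hS : ∀ f : Fin (d + 1) → SobolevCore P, S (fun i => (f i : SobolevSpace P)) =
      cocycle P (fun i => ⇑(toAlgebra P (f i)))) (u : Fin (d + 1) → SobolevSpace P) :
    S (fun i => u (i + 1)) = S u := by
  refine sobolev_tuple_induction (p := fun u => S (fun i => u (i + 1)) = S u)
    (isClosed_eq (S.cont.comp (by fun_prop)) S.cont) (fun f => ?_) u
  exact (hS fun i => f (i + 1)).trans
    ((cocycle_rotate hP hd hd0 fun i => toAlgebra P (f i)).trans (hS f).symm)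

theorem norm_sobolev_cocycle_le (hP : IsGroupoidInvariant P) (hd : Even d) (hd0 : 0 < d)
    (hS : ∀ f : Fin (d + 1) → SobolevCore P, S (fun i => (f i : SobolevSpace P)) =
      cocycle P (fun i => ⇑(toAlgebra P (f i)))) (u : Fin (d + 1) → SobolevSpace P) :
    ‖S u‖ ≤ cocycleBound d *
      (sobolevInftyNorm P (u 0) * ∏ j : Fin d, sobolevDerNorm P (u j.succ)) := by
  have hd2 := div_two_pos_of_even hd hd0
  refine sobolev_tuple_induction (p := fun u => ‖S u‖ ≤ cocycleBound d *
    (sobolevInftyNorm P (u 0) * ∏ j : Fin d, sobolevDerNorm P (u j.succ)))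
    (isClosed_le S.cont.norm ?_) (fun f => ?_) u
  · have h1 := continuous_sobolevInftyNorm (P := P)
    have h2 := continuous_sobolevDerNorm (P := P)
    fun_prop
  rw [hS]
  simp only [sobolevInftyNorm_coe hP hd2, sobolevDerNorm_coe hP hd2]
  exact norm_cocycle_le hP hd hd0 fun i => toAlgebra P (f i)

/-- Each argument of the cocycle can be estimated by the norm of its derivatives, by cyclicity also
the one that is not differentiated in the definition. -/
theorem norm_sobolev_cocycle_le_at (hP : IsGroupoidInvariant P) (hd : Even d) (hd0 : 0 < d)
    (hS : ∀ f : Fin (d + 1) → SobolevCore P, S (fun i => (f i : SobolevSpace P)) =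
      cocycle P (fun i => ⇑(toAlgebra P (f i)))) (u : Fin (d + 1) → SobolevSpace P)
    (i : Fin (d + 1)) :
    ‖S u‖ ≤ cocycleBound d * ∏ j, if j = i then sobolevDerNorm P (u j) else ‖u j‖ := by
  have hd2 := div_two_pos_of_even hd hd0
  have hN := sobolevDerNorm_nonneg hP hd2
  have hI := sobolevInftyNorm_nonneg hP hd2
  have hne : ∀ (u : Fin (d + 1) → SobolevSpace P) (i : Fin (d + 1)), i ≠ 0 →
      ‖S u‖ ≤ cocycleBound d * ∏ j, if j = i then sobolevDerNorm P (u j) else ‖u j‖ := by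
    intro u i hi
    refine (norm_sobolev_cocycle_le hP hd hd0 hS u).trans ?_
    refine mul_le_mul_of_nonneg_left ?_ (cocycleBound_nonneg d)
    rw [Fin.prod_univ_succ, if_neg hi.symm]
    refine mul_le_mul ?_ (Finset.prod_le_prod (fun _ _ => hN _) fun j _ => ?_)
      (Finset.prod_nonneg fun _ _ => hN _) (norm_nonneg _)
    · exact sub_nonneg.1 (hN (u 0))
    · split_ifs
      · exact le_rfl
      · exact sub_le_self _ (hI _)
  by_cases hi : i = 0
  · subst hi
    have : NeZero d := ⟨hd0.ne'⟩
    have h1 : (-1 : Fin (d + 1)) ≠ 0 := by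
      rw [neg_ne_zero, ne_eq, Fin.one_eq_zero_iff]
      omega
    have h2 := hne (fun j => u (j + 1)) (-1) h1
    rw [sobolev_cocycle_rotate hP hd hd0 hS] at h2
    refine h2.trans_eq ?_
    rw [← Equiv.prod_comp (Equiv.addRight (1 : Fin (d + 1)))
      fun j => if j = 0 then sobolevDerNorm P (u j) else ‖u j‖]
    refine congrArg (cocycleBound d * ·) (Finset.prod_congr rfl fun j _ => ?_)
    exact if_congr eq_neg_iff_add_eq_zero rfl rfl
  · exact hne u i hi

theorem norm_sobolev_cocycle_sub_le (hP : IsGroupoidInvariant P) (hd : Even d) (hd0 : 0 < d)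
    (hS : ∀ f : Fin (d + 1) → SobolevCore P, S (fun i => (f i : SobolevSpace P)) =
      cocycle P (fun i => ⇑(toAlgebra P (f i)))) {M : ℝ} {u v : Fin (d + 1) → SobolevSpace P}
    (hu : ∀ i, ‖u i‖ ≤ M) (hv : ∀ i, ‖v i‖ ≤ M) :
    ‖S u - S v‖ ≤ cocycleBound d * M ^ d * ∑ i, sobolevDerNorm P (u i - v i) := by
  have hN := sobolevDerNorm_nonneg hP (div_two_pos_of_even hd hd0)
  have h := S.toMultilinearMap.map_sub_map_piecewise u v Finset.univ
  rw [Finset.piecewise_univ] at h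
  change S u - S v = _ at h
  rw [h, Finset.mul_sum]
  refine (norm_sum_le _ _).trans (Finset.sum_le_sum fun i _ => ?_)
  refine (norm_sobolev_cocycle_le_at hP hd hd0 hS _ i).trans ?_
  rw [mul_assoc]
  refine mul_le_mul_of_nonneg_left ?_ (cocycleBound_nonneg d)
  rw [Fin.prod_univ_succAbove _ i]
  simp only [if_true, Fin.succAbove_ne, if_false, Finset.mem_univ, forall_const, lt_self_iff_false]
  rw [mul_comm]
  refine mul_le_mul_of_nonneg_right ?_ (hN _)
  refine (Finset.prod_le_prod (fun _ _ => norm_nonneg _) (g := fun _ => M) fun j _ => ?_).trans_eq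
    (by simp)
  rw [if_neg (Fin.succAbove_ne i j).symm]
  split_ifs
  · exact hu _
  · exact hv _

end Estimate

end DelonePattern

end

open DelonePattern MeasureTheory in
theorem mainTheorem5 (d : ℕ) (hd : Even d) (hd0 : 0 < d) :
    ∃ C : ℝ → ℝ, ∀ (L₀ : Delone.DeloneSet (Space d)) (P : Measure (Transversal L₀))
      [IsProbabilityMeasure P], IsGroupoidInvariant P →
      -- the Sobolev norm is a seminorm on the core and `SobolevSpace P` is its completion
      (∀ f : Core L₀, ‖toSobolev P f‖ = sobolevNorm P f) ∧
      -- the norm of `L^∞` extends continuously to the Sobolev space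
      (Continuous (sobolevInftyNorm P) ∧
        ∀ f : Core L₀, sobolevInftyNorm P (toSobolev P f) = inftyNorm P f) ∧
      -- the Sobolev space is an algebra with a jointly continuous product
      (∃ mul : SobolevSpace P →L[ℂ] SobolevSpace P →L[ℂ] SobolevSpace P,
        (∀ f g : Core L₀, ∃ h : Core L₀, (h : PatternGroupoid L₀ → ℂ) = conv f g ∧
          mul (toSobolev P f) (toSobolev P g) = toSobolev P h) ∧
        (∀ u v w : SobolevSpace P, mul (mul u v) w = mul u (mul v w)) ∧
        (∀ u v : SobolevSpace P, ‖mul u v‖ ≤ ‖u‖ * ‖v‖)) ∧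
      -- the cocycle is a jointly continuous cyclic multilinear map, controlled by the derivatives
      (∃ S : ContinuousMultilinearMap ℂ (fun _ : Fin (d + 1) => SobolevSpace P) ℂ,
        (∀ f : Fin (d + 1) → Core L₀,
          S (fun i => toSobolev P (f i)) = cocycle P (fun i => (f i : PatternGroupoid L₀ → ℂ))) ∧
        (∀ f : Fin (d + 1) → SobolevSpace P, S (fun i => f (i + 1)) = S f) ∧
        (∀ (M : ℝ) (f f' : Fin (d + 1) → SobolevSpace P),
          (∀ i, ‖f i‖ ≤ M) → (∀ i, ‖f' i‖ ≤ M) →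
          ‖S f - S f'‖ ≤ C M * ∑ i, (‖f i - f' i‖ - sobolevInftyNorm P (f i - f' i)))) := by
  have hd2 := div_two_pos_of_even hd hd0
  refine ⟨fun M => cocycleBound d * M ^ d, fun L₀ P _ hP => ⟨fun f => ?_,
    ⟨continuous_sobolevInftyNorm, fun f => ?_⟩, ⟨sobolevMul hP hd2, fun f g => ?_,
      sobolevMul_assoc hP hd2, norm_sobolevMul_le hP hd2⟩, ?_⟩⟩
  · exact (UniformSpace.Completion.norm_coe (E := SobolevCore P) f).trans
      ((norm_sobolevCore hP hd2 f).trans (ConvAlgebra.sobolevNorm_eq hP hd2 f).symm)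
  · exact (sobolevInftyNorm_coe hP hd2 f).trans (ConvAlgebra.inftyNorm_eq hP f).symm
  · exact ⟨toAlgebra P f * toAlgebra P g, rfl, sobolevMul_coe hP hd2 f g⟩
  · obtain ⟨S, hS⟩ := exists_sobolev_cocycle hP hd hd0
    exact ⟨S, hS, sobolev_cocycle_rotate hP hd hd0 hS,
      fun M f f' hf hf' => norm_sobolev_cocycle_sub_le hP hd hd0 hS hf hf'⟩
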